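/- All graphs are finite, simple and undirected; trees are non-null. A tree-decomposition of a graph $G$ is a family $(B_x : x\in V(T))$ of subsets of $V(G)$ (bags) indexed by the nodes of a tree $T$, such that for each edge $vw$ of $G$ some bag contains both $v$ and $w$, and for each vertex $v$ of $G$ the set $\{x\in V(T) : v\in B_x\}$ induces a non-empty connected subtree of $T$. Its width is $\max_x |B_x|-1$, and the treewidth $\mathrm{tw}(G)$ is the minimum width of a tree-decomposition of $G$. A graph is 1-planar if it has a drawing in the plane with at most one crossing on each edge. A graph $H$ is a topological minor of $G$ if some subgraph of $G$ is a subdivision of $H$. **Theorem.** (a) For every integer $c\ge 0$ and every graph $G_0$ there is a 1-planar graph $G$ such that every tree-decomposition of $G$ of width less than $\mathrm{tw}(G)+c$ has a bag $B$ such that $G_0$ is a topological minor of $G[B]$. (b) Consequently, for all integers $c,w\ge 0$ there is a 1-planar graph $G$ such that every tree-decomposition of $G$ of width at most $\mathrm{tw}(G)+c$ has a bag $B$ with $\mathrm{tw}(G[B])>w$. -/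

import Mathlib

/-- `B` (indexed by the nodes of `T`) is a `T`-decomposition of `G`, and `T` is a (non-null) tree. -/
structure IsTreeDecomposition {V ι : Type*} (G : SimpleGraph V) (T : SimpleGraph ι)
    (B : ι → Finset V) : Prop where
  isTree : T.IsTree
  edge_mem : ∀ v w : V, G.Adj v w → ∃ x : ι, v ∈ B x ∧ w ∈ B x
  /-- the nodes whose bags contain `v` induce a non-empty connected subgraph of `T`
  (`SimpleGraph.Connected` includes non-emptiness) -/
  connected : ∀ v : V, (T.induce {x : ι | v ∈ B x}).Connected

/-- The width `max |B x| - 1`, an integer (it is `-1` when all bags are empty). -/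
def bagWidth {V ι : Type*} [Fintype ι] (B : ι → Finset V) : ℤ :=
  ((Finset.univ.sup fun x => (B x).card : ℕ) : ℤ) - 1

/-- The treewidth of a finite graph: the minimum width of a tree-decomposition
(over finite trees). -/
noncomputable def treewidth {V : Type*} [Finite V] (G : SimpleGraph V) : ℤ :=
  sInf {k : ℤ | ∃ (ι : Type) (_ : Fintype ι) (T : SimpleGraph ι) (B : ι → Finset V),
    IsTreeDecomposition G T B ∧ bagWidth B = k}

/-- `K` is a subdivision of `H`: there are distinct branch vertices `φ u` of `K`, one for each
vertex `u` of `H`, and paths `P u v` of `K`, one for each edge `uv` of `H` (up to the direction of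
traversal), such that the path of `uv` joins `φ u` to `φ v`, its internal vertices are not branch
vertices and lie on no other of these paths, and `K` is the union of the branch vertices and
the paths. -/
def IsSubdivision {U W : Type*} (H : SimpleGraph U) (K : SimpleGraph W) : Prop :=
  ∃ (φ : U ↪ W) (P : ∀ u v : U, H.Adj u v → K.Walk (φ u) (φ v)),
    (∀ u v (h : H.Adj u v), (P u v h).IsPath) ∧
    (∀ u v (h : H.Adj u v), P v u h.symm = (P u v h).reverse) ∧
    (∀ u v (h : H.Adj u v) (w : U), φ w ∈ (P u v h).support → w = u ∨ w = v) ∧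
    (∀ u v (h : H.Adj u v) u' v' (h' : H.Adj u' v'), s(u, v) ≠ s(u', v') →
      ∀ x, x ∈ (P u v h).support → x ∈ (P u' v' h').support → x ∈ Set.range φ) ∧
    (∀ x : W, x ∈ Set.range φ ∨ ∃ u v, ∃ h : H.Adj u v, x ∈ (P u v h).support) ∧
    (∀ x y : W, K.Adj x y → ∃ u v, ∃ h : H.Adj u v, s(x, y) ∈ (P u v h).edges)

/-- `H` is a topological minor of `G`: some subgraph of `G` is a subdivision of `H`. -/
def IsTopologicalMinor {U V : Type*} (H : SimpleGraph U) (G : SimpleGraph V) : Prop :=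
  ∃ K : G.Subgraph, IsSubdivision H K.coe

/-- A drawing of `G` in the plane: vertices are distinct points, each edge `uv` is a simple arc
joining the points of `u` and `v` and containing no other vertex. (`arc` is irrelevant on
non-edges.) -/
structure PlaneDrawing {V : Type*} (G : SimpleGraph V) where
  point : V ↪ ℝ × ℝ
  arc : Sym2 V → Set (ℝ × ℝ)
  exists_path : ∀ u v : V, G.Adj u v →
    ∃ γ : Path (point u) (point v), Function.Injective γ ∧ Set.range γ = arc s(u, v)
  vertex_mem_arc : ∀ u v w : V, G.Adj u v → point w ∈ arc s(u, v) → w = u ∨ w = v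

/-- The crossings on the edge `e`: pairs `(f, p)` of another edge `f` and a point `p`, not a vertex,
that is common to `e` and `f`. (A point shared with two other edges counts twice.) -/
def PlaneDrawing.crossings {V : Type*} {G : SimpleGraph V} (D : PlaneDrawing G) (e : Sym2 V) :
    Set (Sym2 V × (ℝ × ℝ)) :=
  {q | q.1 ∈ G.edgeSet ∧ q.1 ≠ e ∧ q.2 ∈ D.arc e ∧ q.2 ∈ D.arc q.1 ∧ q.2 ∉ Set.range D.point}

/-- `G` is 1-planar: it has a drawing in the plane with at most one crossing on each edge. -/
def IsOnePlanar {V : Type*} (G : SimpleGraph V) : Prop :=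
  ∃ D : PlaneDrawing G, ∀ e ∈ G.edgeSet, (D.crossings e).encard ≤ 1

/-! The graph contains a subdivision of a complete graph on `N = |V₀| + c` branch vertices. Each of
its vertices, called a hub, also starts three lanes, one of each type. After the subdivision is
complete, the lanes of each type form a grid whose columns are the `n` lanes of that type, with more
rows than a bag has vertices.

The treewidth is at most `n`: the bag of all hubs is the root of three arms, and on arm `k` a front
of `n` lane vertices of type `k` climbs one vertex at a time, with bags of size at most `n + 1`
(`LaneSystem.treewidth_le`). So a decomposition of width less than `tw + c` has bags of size at most
`n + c`.

Conversely, in such a decomposition each grid forces a node `t k` whose bag meets every lane of type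
`k`. For each hub, the union of two of its lanes is connected through the hub, and its subtree
contains both corresponding nodes. Two pairs of types out of three always share a type, so these
subtrees pairwise intersect, and by the Helly property one bag meets all these unions. If it misses
a hub, it meets at least two lanes of that hub; otherwise it contains the hub. It thus has at least
`n` plus the number of missing hubs elements, so at most `c` hubs are missing
(`LaneSystem.exists_bag_hubs`). They spoil at most `c` branch vertices, and the others carry a
subdivision of `G₀` inside the bag.

For 1-planarity the graph is drawn row by row. A row is a word whose letters are the strands of the
subdivision and the lanes already started, and between consecutive rows at most one pair of
neighbouring letters is swapped. Such swaps bring the two halves of each subdivided edge together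
and then sort the lanes by type (`nonempty_schedule`). The new lanes started meanwhile are routed so
that they do not block this process. -/

/-! ### Straight-line drawings of layered graphs. -/

/-- Two edges between consecutive rows, `ab` and `a'b'` with `a`, `a'` in the lower row, are
inverted if their ends appear in opposite orders in the two rows. -/
def Inverted {V : Type*} (x : V → ℕ) (a b a' b' : V) : Prop :=
  (x a < x a' ∧ x b' < x b) ∨ (x a' < x a ∧ x b < x b')

/-- The point of the plane with the given integer coordinates. -/
def gridPoint {V : Type*} (x y : V → ℕ) (v : V) : ℝ × ℝ := ((x v : ℝ), (y v : ℝ))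

/-- The straight-line segment of an edge. -/
def straightArc {V : Type*} (x y : V → ℕ) (e : Sym2 V) : Set (ℝ × ℝ) :=
  {p | ∃ u v, e = s(u, v) ∧ p ∈ segment ℝ (gridPoint x y u) (gridPoint x y v)}

theorem straightArc_mk {V : Type*} (x y : V → ℕ) (u v : V) :
    straightArc x y s(u, v) = segment ℝ (gridPoint x y u) (gridPoint x y v) := by
  ext p
  constructor
  · rintro ⟨a, b, h, hp⟩
    rcases Sym2.eq_iff.1 h with ⟨rfl, rfl⟩ | ⟨rfl, rfl⟩
    · exact hp
    · rwa [segment_symm]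
  · exact fun hp => ⟨u, v, rfl, hp⟩

theorem exists_param_of_mem_straightArc {V : Type*} {x y : V → ℕ} {u v : V} {p : ℝ × ℝ}
    (h : p ∈ straightArc x y s(u, v)) :
    ∃ t : ℝ, 0 ≤ t ∧ t ≤ 1 ∧ p.1 = x u + t * (x v - x u) ∧ p.2 = y u + t * (y v - y u) := by
  rw [straightArc_mk, segment_eq_image] at h
  obtain ⟨t, ⟨h0, h1⟩, rfl⟩ := h
  refine ⟨t, h0, h1, ?_, ?_⟩ <;> simp [gridPoint] <;> ring

theorem gridPoint_injective {V : Type*} {x y : V → ℕ}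
    (hinj : ∀ u v, x u = x v → y u = y v → u = v) : Function.Injective (gridPoint x y) := by
  intro u v h
  simp only [gridPoint, Prod.mk.injEq, Nat.cast_inj] at h
  exact hinj u v h.1 h.2

/-- An edge of a layered graph, oriented upwards or to the right. -/
theorem exists_oriented_of_mem_edgeSet {V : Type*} {G : SimpleGraph V} {x y : V → ℕ}
    (hadj : ∀ u v, G.Adj u v → y v = y u + 1 ∨ y u = y v + 1 ∨
      (y u = y v ∧ (x v = x u + 1 ∨ x u = x v + 1)))
    {e : Sym2 V} (he : e ∈ G.edgeSet) :
    ∃ u v, e = s(u, v) ∧ G.Adj u v ∧ (y v = y u + 1 ∨ (y v = y u ∧ x v = x u + 1)) := by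
  induction e using Sym2.ind with
  | _ u v =>
    have h : G.Adj u v := he
    rcases hadj u v h with h1 | h1 | ⟨h1, h2 | h2⟩
    · exact ⟨u, v, rfl, h, Or.inl h1⟩
    · exact ⟨v, u, Sym2.eq_swap, h.symm, Or.inl h1⟩
    · exact ⟨u, v, rfl, h, Or.inr ⟨h1.symm, h2⟩⟩
    · exact ⟨v, u, Sym2.eq_swap, h.symm, Or.inr ⟨h1, h2⟩⟩

theorem eq_zero_or_one_of_add_eq_natCast {a b : ℕ} {t : ℝ} (h0 : 0 ≤ t) (h1 : t ≤ 1)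
    (h : (b : ℝ) = a + t) : t = 0 ∨ t = 1 := by
  have ha : (a : ℝ) ≤ b := by linarith
  have hb : (b : ℝ) ≤ (a + 1 : ℕ) := by push_cast; linarith
  have ha' : a ≤ b := by exact_mod_cast ha
  have hb' : b ≤ a + 1 := by exact_mod_cast hb
  rcases (show b = a ∨ b = a + 1 by omega) with rfl | rfl
  · left; linarith
  · right; push_cast at h; linarith

theorem param_mem_Ioo {V : Type*} {x y : V → ℕ} {u v : V} {p : ℝ × ℝ} {t : ℝ}
    (h0 : 0 ≤ t) (h1 : t ≤ 1) (hp1 : p.1 = x u + t * (x v - x u))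
    (hp2 : p.2 = y u + t * (y v - y u)) (hp : p ∉ Set.range (gridPoint x y)) : 0 < t ∧ t < 1 := by
  constructor
  · refine lt_of_le_of_ne h0 fun h => hp ⟨u, ?_⟩
    subst h
    ext
    · simpa [gridPoint] using hp1.symm
    · simpa [gridPoint] using hp2.symm
  · refine lt_of_le_of_ne h1 fun h => hp ⟨v, ?_⟩
    subst h
    ext
    · simpa [gridPoint] using hp1.symm
    · simpa [gridPoint] using hp2.symm

/-- The straight-line drawing of a layered graph. -/
noncomputable def layeredDrawing {V : Type*} (G : SimpleGraph V) (x y : V → ℕ)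
    (hinj : ∀ u v, x u = x v → y u = y v → u = v)
    (hadj : ∀ u v, G.Adj u v → y v = y u + 1 ∨ y u = y v + 1 ∨
      (y u = y v ∧ (x v = x u + 1 ∨ x u = x v + 1))) : PlaneDrawing G where
  point := ⟨gridPoint x y, gridPoint_injective hinj⟩
  arc := straightArc x y
  exists_path u v h := by
    refine ⟨Path.segment _ _, Path.segment_injective_of_ne ?_, ?_⟩
    · exact fun h' => h.ne (gridPoint_injective hinj h')
    · rw [Path.range_segment, straightArc_mk]; rfl
  vertex_mem_arc u v w h hw := by
    obtain ⟨u', v', he, -, h'⟩ := exists_oriented_of_mem_edgeSet hadj ((G.mem_edgeSet).2 h)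
    suffices w = u' ∨ w = v' by
      rcases Sym2.eq_iff.1 he with ⟨rfl, rfl⟩ | ⟨rfl, rfl⟩
      · exact this
      · exact this.symm
    rw [he] at hw
    obtain ⟨t, h0, h1, hp1, hp2⟩ := exists_param_of_mem_straightArc hw
    simp only [Function.Embedding.coeFn_mk, gridPoint] at hp1 hp2
    -- One coordinate grows by exactly 1 along the edge, so at a lattice point the parameter is an
    -- integer.
    have ht : t = 0 ∨ t = 1 := by
      rcases h' with h' | ⟨h', h''⟩
      · refine eq_zero_or_one_of_add_eq_natCast h0 h1 (a := y u') (b := y w) ?_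
        rw [hp2, h']; push_cast; ring
      · refine eq_zero_or_one_of_add_eq_natCast h0 h1 (a := x u') (b := x w) ?_
        rw [hp1, h'']; push_cast; ring
    rcases ht with rfl | rfl
    · left
      refine hinj _ _ ?_ ?_
      · have : (x w : ℝ) = x u' := by linarith
        exact_mod_cast this
      · have : (y w : ℝ) = y u' := by linarith
        exact_mod_cast this
    · right
      refine hinj _ _ ?_ ?_
      · have : (x w : ℝ) = x v' := by linarith
        exact_mod_cast this
      · have : (y w : ℝ) = y v' := by linarith
        exact_mod_cast this

/-- A layered graph in which each edge is inverted with at most one other is 1-planar. -/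
theorem isOnePlanar_of_layered {V : Type*} (G : SimpleGraph V) (x y : V → ℕ)
    (hinj : ∀ u v, x u = x v → y u = y v → u = v)
    (hadj : ∀ u v, G.Adj u v → y v = y u + 1 ∨ y u = y v + 1 ∨
      (y u = y v ∧ (x v = x u + 1 ∨ x u = x v + 1)))
    (hinv : ∀ a b a' b' a'' b'', G.Adj a b → G.Adj a' b' → G.Adj a'' b'' →
      y b = y a + 1 → y a' = y a → y b' = y a + 1 → y a'' = y a → y b'' = y a + 1 →
      Inverted x a b a' b' → Inverted x a b a'' b'' → a' = a'' ∧ b' = b'') :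
    IsOnePlanar G := by
  refine ⟨layeredDrawing G x y hinj hadj, fun e he => ?_⟩
  rw [Set.encard_le_one_iff]
  obtain ⟨a, b, rfl, hab, h⟩ := exists_oriented_of_mem_edgeSet hadj he
  have key : ∀ q ∈ (layeredDrawing G x y hinj hadj).crossings s(a, b),
      ∃ a' b' : V, ∃ t : ℝ, q.1 = s(a', b') ∧ G.Adj a' b' ∧ y b = y a + 1 ∧ y a' = y a ∧
        y b' = y a + 1 ∧ Inverted x a b a' b' ∧ q.2.1 = x a + t * (x b - x a) ∧ q.2.2 = y a + t ∧
        q.2.1 = x a' + t * (x b' - x a') := by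
    rintro ⟨f, p⟩ ⟨hf, hfe, hpe, hpf, hpv⟩
    obtain ⟨a', b', rfl, hab', h'⟩ := exists_oriented_of_mem_edgeSet hadj hf
    obtain ⟨t, h0, h1, hp1, hp2⟩ := exists_param_of_mem_straightArc hpe
    obtain ⟨t', h0', h1', hp1', hp2'⟩ := exists_param_of_mem_straightArc hpf
    obtain ⟨ht0, ht1⟩ := param_mem_Ioo h0 h1 hp1 hp2 hpv
    obtain ⟨ht0', ht1'⟩ := param_mem_Ioo h0' h1' hp1' hp2' hpv
    simp only at hp1 hp2 hp1' hp2' hfe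
    have hne : ¬ (a' = a ∧ b' = b) := by rintro ⟨rfl, rfl⟩; exact hfe rfl
    have aux : ∀ {m k : ℕ} {s s' : ℝ}, 0 < s → s < 1 → 0 < s' → s' < 1 → (m : ℝ) + s = k + s' →
        m = k := by
      intro m k s s' hs hs1 hs' hs1' hmk
      have h1 : (m : ℝ) < (k + 1 : ℕ) := by push_cast; linarith
      have h2 : (k : ℝ) < (m + 1 : ℕ) := by push_cast; linarith
      have h1' : m < k + 1 := by exact_mod_cast h1
      have h2' : k < m + 1 := by exact_mod_cast h2
      omega
    have aux' : ∀ {m k : ℕ} {s : ℝ}, 0 < s → s < 1 → (m : ℝ) + s ≠ k := by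
      intro m k s hs hs1 hmk
      rcases eq_zero_or_one_of_add_eq_natCast hs.le hs1.le hmk.symm with h | h <;> linarith
    -- The interior of a rising edge lies strictly between two rows, that of a horizontal edge on a
    -- row, and distinct horizontal edges have disjoint interiors. Only two rising edges between the
    -- same rows can cross, and then at equal parameters.
    rcases h with h | ⟨h, hx⟩ <;> rcases h' with h' | ⟨h', hx'⟩
    · rw [h] at hp2; rw [h'] at hp2'
      push_cast at hp2 hp2'
      have hyy : y a = y a' := aux ht0 ht1 ht0' ht1' (by linarith)
      have htt : t = t' := by rw [hyy] at hp2; linarith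
      subst htt
      refine ⟨a', b', t, rfl, hab', h, hyy.symm, by omega, ?_, hp1, by linarith, hp1'⟩
      by_contra hI
      simp only [Inverted, not_or, not_and, not_lt] at hI
      have hs : (0 : ℝ) < 1 - t := by linarith
      -- The horizontal offset at height `t` is a convex combination of the offsets at the two ends.
      -- It vanishes only if these have opposite signs or are both zero.
      have heq : ((x a : ℝ) - x a') * (1 - t) + ((x b : ℝ) - x b') * t = 0 := by
        linear_combination hp1' - hp1
      rcases lt_trichotomy (x a) (x a') with hlt | heqa | hgt
      · have h2 := hI.1 hlt
        have h3 : (x a : ℝ) < x a' := by exact_mod_cast hlt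
        have h4 : (x b : ℝ) ≤ x b' := by exact_mod_cast h2
        nlinarith
      · rw [heqa] at heq
        have : (x b : ℝ) = x b' := by
          have : ((x b : ℝ) - x b') * t = 0 := by linarith
          rcases mul_eq_zero.1 this with h5 | h5 <;> linarith
        exact hne ⟨(hinj _ _ heqa hyy).symm,
          (hinj _ _ (by exact_mod_cast this) (by omega)).symm⟩
      · have h2 := hI.2 hgt
        have h3 : (x a' : ℝ) < x a := by exact_mod_cast hgt
        have h4 : (x b' : ℝ) ≤ x b := by exact_mod_cast h2
        nlinarith
    · rw [h] at hp2; rw [h'] at hp2'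
      push_cast at hp2 hp2'
      exact absurd (show (y a : ℝ) + t = y a' by linarith) (aux' ht0 ht1)
    · rw [h] at hp2; rw [h'] at hp2'
      push_cast at hp2 hp2'
      exact absurd (show (y a' : ℝ) + t' = y a by linarith) (aux' ht0' ht1')
    · rw [h] at hp2; rw [h'] at hp2'
      rw [hx] at hp1; rw [hx'] at hp1'
      push_cast at hp1 hp1'
      have hxx : x a = x a' := aux ht0 ht1 ht0' ht1' (by linarith)
      have hyy : y a = y a' := by
        have : (y a : ℝ) = y a' := by linarith
        exact_mod_cast this
      exact absurd ⟨(hinj _ _ hxx hyy).symm, (hinj _ _ (by omega) (by omega)).symm⟩ hne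
  rintro q q' hq hq'
  obtain ⟨a', b', t, hq1, hab', hy, hya, hyb, hI, hp, hpy, hp'⟩ := key q hq
  obtain ⟨a'', b'', t', hq1', hab'', -, hya', hyb', hI', hq, hqy, hq'⟩ := key q' hq'
  obtain ⟨rfl, rfl⟩ := hinv a b a' b' a'' b'' hab hab' hab'' hy hya hyb hya' hyb' hI hI'
  have htt : t = t' := by
    -- The offset of two inverted edges is affine in `t` with non-zero slope, so they meet only
    -- once.
    have h1 : (t - t') * (((x a : ℝ) - x a') + ((x b' : ℝ) - x b)) = 0 := by
      linear_combination hp - hp' - hq + hq'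
    rcases mul_eq_zero.1 h1 with h2 | h2
    · linarith
    · rcases hI with ⟨h3, h4⟩ | ⟨h3, h4⟩
      · have h3' : (x a : ℝ) < x a' := by exact_mod_cast h3
        have h4' : (x b' : ℝ) < x b := by exact_mod_cast h4
        linarith
      · have h3' : (x a' : ℝ) < x a := by exact_mod_cast h3
        have h4' : (x b : ℝ) < x b' := by exact_mod_cast h4
        linarith
  subst htt
  refine Prod.ext (hq1.trans hq1'.symm) (Prod.ext (hp.trans hq.symm) (hpy.trans hqy.symm))

/-! ### Connected sets and the Helly property of subtrees. -/

/-- `x` and `y` are joined by a walk of `G` inside `X`. -/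
def Linked {V : Type*} (G : SimpleGraph V) (X : Set V) (x y : V) : Prop :=
  ∃ p : G.Walk x y, ∀ z ∈ p.support, z ∈ X

namespace Linked

variable {V : Type*} {G : SimpleGraph V} {X Y : Set V} {x y z : V}

theorem refl (h : x ∈ X) : Linked G X x x := ⟨.nil, by simpa using h⟩

theorem symm (h : Linked G X x y) : Linked G X y x := by
  obtain ⟨p, hp⟩ := h
  exact ⟨p.reverse, by simpa using hp⟩

theorem trans (h : Linked G X x y) (h' : Linked G X y z) : Linked G X x z := by
  obtain ⟨p, hp⟩ := h
  obtain ⟨q, hq⟩ := h'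
  refine ⟨p.append q, fun w hw => ?_⟩
  rcases (SimpleGraph.Walk.mem_support_append_iff _ _).1 hw with h | h
  · exact hp w h
  · exact hq w h

theorem mono (hXY : X ⊆ Y) (h : Linked G X x y) : Linked G Y x y := by
  obtain ⟨p, hp⟩ := h
  exact ⟨p, fun z hz => hXY (hp z hz)⟩

theorem of_adj (h : G.Adj x y) (hx : x ∈ X) (hy : y ∈ X) : Linked G X x y :=
  ⟨.cons h .nil, by simp [hx, hy]⟩

theorem of_chain {f : ℕ → V} {a b : ℕ} (hab : a ≤ b)
    (hadj : ∀ r, a ≤ r → r < b → G.Adj (f r) (f (r + 1))) (hX : ∀ r, a ≤ r → r ≤ b → f r ∈ X) :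
    Linked G X (f a) (f b) := by
  induction b, hab using Nat.le_induction with
  | base => exact refl (hX a le_rfl le_rfl)
  | succ b hab ih =>
    refine (ih (fun r h1 h2 => hadj r h1 (by omega)) (fun r h1 h2 => hX r h1 (by omega))).trans ?_
    exact of_adj (hadj b hab (by omega)) (hX b hab (by omega)) (hX _ (by omega) le_rfl)

end Linked

/-- Any two elements of `X` are joined by a walk of `G` inside `X`. -/
def ConnectedIn {V : Type*} (G : SimpleGraph V) (X : Set V) : Prop :=
  ∀ x ∈ X, ∀ y ∈ X, Linked G X x y

theorem ConnectedIn.of_center {V : Type*} {G : SimpleGraph V} {X : Set V} (c : V)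
    (h : ∀ x ∈ X, Linked G X c x) : ConnectedIn G X :=
  fun x hx y hy => (h x hx).symm.trans (h y hy)

theorem connectedIn_of_induce_connected {V : Type*} {G : SimpleGraph V} {X : Set V}
    (h : (G.induce X).Connected) : ConnectedIn G X := by
  have key : ∀ a b : X, (G.induce X).Walk a b → Linked G X a b := by
    intro a b p
    induction p with
    | nil => exact .refl (Subtype.prop _)
    | @cons u v _ hadj _ ih =>
      have hadj' : G.Adj u v := hadj
      exact (Linked.of_adj hadj' u.2 v.2).trans ih
  intro x hx y hy
  obtain ⟨p⟩ := h.preconnected ⟨x, hx⟩ ⟨y, hy⟩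
  exact key _ _ p

theorem induce_connected_of_center {V : Type*} {G : SimpleGraph V} {X : Set V} {c : V}
    (hc : c ∈ X) (h : ∀ x ∈ X, Linked G X x c) : (G.induce X).Connected := by
  have : Nonempty X := ⟨⟨c, hc⟩⟩
  have key : ∀ x : X, (G.induce X).Reachable x ⟨c, hc⟩ := by
    rintro ⟨x, hx⟩
    obtain ⟨p, hp⟩ := h x hx
    exact ⟨p.induce X hp⟩
  exact ⟨fun x y => (key x).trans (key y).symm⟩

/-- In a tree, a path inside a set continued by a path that leaves the set at once is a path;
hence the vertex of a connected set nearest to `c` lies on all paths from the set to `c`. -/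
theorem exists_nearest {ι : Type*} {T : SimpleGraph ι} (hT : T.IsTree) (c : ι) {S : Set ι}
    (hS : ConnectedIn T S) (hne : S.Nonempty) :
    ∃ t ∈ S, ∀ x ∈ S, ∃ (q : T.Walk x t) (p : T.Walk t c), (q.append p).IsPath ∧
      (∀ z ∈ q.support, z ∈ S) ∧ ∀ z ∈ p.support, z ≠ t → T.dist z c < T.dist t c := by
  classical
  obtain ⟨u, hu, hmin'⟩ : ∃ u ∈ S, ∀ x ∈ S, T.dist u c ≤ T.dist x c :=
    ⟨_, Function.argminOn_mem _ S hne, fun x hx => Function.argminOn_le (T.dist · c) S hx⟩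
  refine ⟨u, hu, fun x hx => ?_⟩
  obtain ⟨p, hp, hlen⟩ := (hT.connected.preconnected u c).exists_path_of_dist
  have hlt : ∀ z ∈ p.support, z ≠ u → T.dist z c < T.dist u c := by
    intro z hz hzu
    have h1 := SimpleGraph.dist_le (p.dropUntil z hz)
    have h2 := congrArg SimpleGraph.Walk.length (p.take_spec hz)
    rw [SimpleGraph.Walk.length_append] at h2
    have h3 : 0 < (p.takeUntil z hz).length := by
      rw [Nat.pos_iff_ne_zero]
      intro h0
      exact hzu (SimpleGraph.Walk.eq_of_length_eq_zero h0).symm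
    omega
  obtain ⟨q, hq⟩ := hS x hx u hu
  have hq' : ∀ z ∈ q.bypass.support, z ∈ S := fun z hz => hq z (q.support_bypass_subset_support hz)
  refine ⟨q.bypass, p, ?_, hq', hlt⟩
  rw [SimpleGraph.Walk.isPath_def, SimpleGraph.Walk.support_append, List.nodup_append']
  refine ⟨(q.bypass_isPath).support_nodup, ?_, ?_⟩
  · exact hp.support_nodup.sublist (List.tail_sublist _)
  -- Beyond `u`, the vertices of `p` are closer to `c` than any element of `S`, so `p` does not
  -- return to `S`.
  · intro z hz hz'
    have hzS := hq' z hz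
    have hzu : z ≠ u := by
      rintro rfl
      have := hp.support_nodup
      rw [← SimpleGraph.Walk.cons_tail_support] at this
      exact (List.nodup_cons.1 this).1 hz'
    have := hlt z (List.mem_of_mem_tail hz') hzu
    have := hmin' z hzS
    omega

/-- The Helly property of subtrees. -/
theorem exists_mem_of_pairwise_inter {ι : Type*} [Finite ι] {T : SimpleGraph ι} (hT : T.IsTree)
    {F : Set (Set ι)} (hF : ∀ S ∈ F, ConnectedIn T S)
    (hinter : ∀ S ∈ F, ∀ S' ∈ F, (S ∩ S').Nonempty) : ∃ t, ∀ S ∈ F, t ∈ S := by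
  classical
  have := hT.connected.nonempty
  have c := this.some
  rcases F.eq_empty_or_nonempty with rfl | hne
  · exact ⟨c, by simp⟩
  have hne' : ∀ S ∈ F, S.Nonempty := fun S hS => (hinter S hS S hS).mono Set.inter_subset_left
  choose! top htop hpath using fun S hS => exists_nearest hT c (hF S hS) (hne' S hS)
  -- Root the tree at `c`. The top farthest from the root belongs to every member: the path to `c`
  -- from a common node of `S` and `S'` passes both tops, and the top of `S` cannot lie beyond that
  -- of `S'`, where nodes are closer to `c`.
  obtain ⟨S, hS, hmax⟩ := Set.exists_max_image F (fun S => T.dist (top S) c) (Set.toFinite F) hne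
  refine ⟨top S, fun S' hS' => ?_⟩
  obtain ⟨x, hxS, hxS'⟩ := hinter S hS S' hS'
  obtain ⟨q, p, hqp, hq, hp⟩ := hpath S hS x hxS
  obtain ⟨q', p', hqp', hq', hp'⟩ := hpath S' hS' x hxS'
  have heq : q.append p = q'.append p' := (hT.existsUnique_path x c).unique hqp hqp'
  have hmem : top S ∈ (q'.append p').support := by
    rw [← heq, SimpleGraph.Walk.mem_support_append_iff]
    exact Or.inl q.end_mem_support
  rcases (SimpleGraph.Walk.mem_support_append_iff _ _).1 hmem with h | h
  · exact hq' _ h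
  · by_cases hts : top S = top S'
    · rw [hts]; exact htop S' hS'
    · have := hp' _ h hts
      have := hmax S' hS'
      omega

/-! ### Connected sets of vertices in tree-decompositions. -/

/-- The nodes whose bags meet `X`. -/
def hittingNodes {V ι : Type*} (B : ι → Finset V) (X : Set V) : Set ι :=
  {t | ∃ v ∈ X, v ∈ B t}

theorem IsTreeDecomposition.exists_node {V ι : Type*} {G : SimpleGraph V} {T : SimpleGraph ι}
    {B : ι → Finset V} (h : IsTreeDecomposition G T B) (v : V) : ∃ t, v ∈ B t := by
  obtain ⟨⟨t, ht⟩⟩ := (h.connected v).nonempty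
  exact ⟨t, ht⟩

/-- Along a walk in `X`, the subtrees of consecutive vertices intersect in a node whose bag contains
the edge. -/
theorem IsTreeDecomposition.connectedIn_hittingNodes {V ι : Type*} {G : SimpleGraph V}
    {T : SimpleGraph ι} {B : ι → Finset V} (h : IsTreeDecomposition G T B) {X : Set V}
    (hX : ConnectedIn G X) : ConnectedIn T (hittingNodes B X) := by
  have key : ∀ (u v : V) (p : G.Walk u v), (∀ z ∈ p.support, z ∈ X) → ∀ s t, u ∈ B s → v ∈ B t →
      Linked T (hittingNodes B X) s t := by
    intro u v p
    have single : ∀ w ∈ X, ∀ s t, w ∈ B s → w ∈ B t → Linked T (hittingNodes B X) s t :=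
      fun w hw s t hs ht =>
        (connectedIn_of_induce_connected (h.connected w) s hs t ht).mono fun r hr => ⟨w, hw, hr⟩
    induction p with
    | nil => exact fun hp s t hs ht => single _ (hp _ (by simp)) s t hs ht
    | @cons u w v hadj p ih =>
      intro hp s t hs ht
      obtain ⟨r, hru, hrw⟩ := h.edge_mem _ _ hadj
      refine (single u (hp u (by simp)) s r hs hru).trans (ih (fun z hz => hp z ?_) r t hrw ht)
      simp [hz]
  rintro s ⟨u, huX, hus⟩ t ⟨v, hvX, hvt⟩
  obtain ⟨p, hp⟩ := hX u huX v hvX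
  exact key u v p hp s t hus hvt

/-- A bag meets all members of a family of connected sets that pairwise intersect or are joined by
an edge. -/
theorem IsTreeDecomposition.exists_bag_meeting {V ι κ : Type*} [Finite ι] {G : SimpleGraph V}
    {T : SimpleGraph ι} {B : ι → Finset V} (h : IsTreeDecomposition G T B) (X : κ → Set V)
    (hX : ∀ i, ConnectedIn G (X i))
    (htouch : ∀ i j, ∃ u ∈ X i, ∃ v ∈ X j, u = v ∨ G.Adj u v) :
    ∃ t, ∀ i, ∃ v ∈ X i, v ∈ B t := by
  obtain ⟨t, ht⟩ := exists_mem_of_pairwise_inter h.isTree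
    (F := Set.range fun i => hittingNodes B (X i))
    (by rintro _ ⟨i, rfl⟩; exact h.connectedIn_hittingNodes (hX i))
    (by
      rintro _ ⟨i, rfl⟩ _ ⟨j, rfl⟩
      obtain ⟨u, hu, v, hv, rfl | huv⟩ := htouch i j
      · obtain ⟨t, ht⟩ := h.exists_node u
        exact ⟨t, ⟨u, hu, ht⟩, ⟨u, hv, ht⟩⟩
      · obtain ⟨t, ht, ht'⟩ := h.edge_mem _ _ huv
        exact ⟨t, ⟨u, hu, ht⟩, ⟨v, hv, ht'⟩⟩)
  exact ⟨t, fun i => ht _ ⟨i, rfl⟩⟩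

/-! ### Rooted trees and upper bounds for the treewidth. -/

/-- The graph joining each element other than `root` to its parent. -/
def parentGraph {ι : Type*} (root : ι) (p : ι → ι) : SimpleGraph ι :=
  SimpleGraph.fromRel fun x y => x ≠ root ∧ y = p x

theorem parentGraph_adj {ι : Type*} {root : ι} {p : ι → ι} {rank : ι → ℕ}
    (hrank : ∀ x, x ≠ root → rank (p x) < rank x) {x : ι} (hx : x ≠ root) :
    (parentGraph root p).Adj x (p x) := by
  refine (SimpleGraph.fromRel_adj _ _ _).2 ⟨fun h => ?_, Or.inl ⟨hx, rfl⟩⟩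
  have := hrank x hx
  rw [← h] at this
  omega

/-- Passing to the parent lowers the rank, so the climb inside `S` must stop, and it can stop only
at `t`. -/
theorem linked_top {ι : Type*} {root : ι} {p : ι → ι} {rank : ι → ℕ}
    (hrank : ∀ x, x ≠ root → rank (p x) < rank x) {S : Set ι} {t : ι}
    (hS : ∀ x ∈ S, x ≠ t → x ≠ root ∧ p x ∈ S) :
    ∀ x ∈ S, Linked (parentGraph root p) S x t := by
  intro x
  induction hn : rank x using Nat.strong_induction_on generalizing x with
  | _ n ih =>
    intro hx
    by_cases hxt : x = t
    · subst hxt; exact Linked.refl hx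
    · obtain ⟨h1, h2⟩ := hS x hx hxt
      have h3 := hrank x h1
      exact (Linked.of_adj (parentGraph_adj hrank h1) hx h2).trans (ih _ (hn ▸ h3) _ rfl h2)

/-- Each edge is determined by its child, which is not the root, so a connected graph with at most
`|ι| - 1` edges results. -/
theorem isTree_parentGraph {ι : Type*} [Finite ι] {root : ι} {p : ι → ι} {rank : ι → ℕ}
    (hrank : ∀ x, x ≠ root → rank (p x) < rank x) : (parentGraph root p).IsTree := by
  classical
  have hconn : (parentGraph root p).Connected := by
    have : Nonempty ι := ⟨root⟩
    have key : ∀ x, (parentGraph root p).Reachable x root := fun x => by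
      obtain ⟨q, -⟩ := linked_top hrank (S := Set.univ) (t := root) (fun y _ hy => ⟨hy, trivial⟩)
        x trivial
      exact ⟨q⟩
    exact ⟨fun x y => (key x).trans (key y).symm⟩
  have := Fintype.ofFinite ι
  refine SimpleGraph.isTree_iff_connected_and_card.2 ⟨hconn, le_antisymm ?_ ?_⟩
  · have hsub : (parentGraph root p).edgeSet ⊆ (fun x => s(x, p x)) '' {root}ᶜ := by
      intro e
      induction e using Sym2.ind with
      | _ x y =>
        intro h
        rcases ((SimpleGraph.fromRel_adj _ _ _).1 ((SimpleGraph.mem_edgeSet _).1 h)).2 with ⟨h1, rfl⟩ | ⟨h1, rfl⟩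
        · exact ⟨x, h1, rfl⟩
        · exact ⟨y, h1, Sym2.eq_swap⟩
    have h1 : (parentGraph root p).edgeSet.ncard ≤ ({root}ᶜ : Set ι).ncard :=
      (Set.ncard_le_ncard hsub (Set.toFinite _)).trans (Set.ncard_image_le (Set.toFinite _))
    have h2 := Set.ncard_add_ncard_compl ({root} : Set ι)
    rw [Set.ncard_singleton] at h2
    rw [Nat.card_coe_set_eq]
    omega
  · exact hconn.card_vert_le_card_edgeSet_add_one

/-- Connectivity becomes local: the nodes of `v` have a top, and every other one passes `v` on to
its parent. -/
theorem isTreeDecomposition_parentGraph {V ι : Type*} [Finite ι] {G : SimpleGraph V} {root : ι}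
    {p : ι → ι} {rank : ι → ℕ} (hrank : ∀ x, x ≠ root → rank (p x) < rank x) {B : ι → Finset V}
    (hedge : ∀ v w, G.Adj v w → ∃ x, v ∈ B x ∧ w ∈ B x)
    (htop : ∀ v, ∃ t, v ∈ B t ∧ ∀ x, v ∈ B x → x ≠ t → x ≠ root ∧ v ∈ B (p x)) :
    IsTreeDecomposition G (parentGraph root p) B where
  isTree := isTree_parentGraph hrank
  edge_mem := hedge
  connected v := by
    obtain ⟨t, ht, h⟩ := htop v
    exact induce_connected_of_center ht (linked_top hrank h)

theorem treewidth_le {V ι : Type} [Finite V] [Fintype ι] {G : SimpleGraph V} {T : SimpleGraph ι}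
    {B : ι → Finset V} (h : IsTreeDecomposition G T B) {k : ℕ} (hk : ∀ x, (B x).card ≤ k + 1) :
    treewidth G ≤ k := by
  have h1 : treewidth G ≤ bagWidth B := by
    -- An infimum of integers is meaningful only for sets bounded below; no width is less than `-1`.
    refine csInf_le ⟨-1, ?_⟩ ⟨ι, inferInstance, T, B, h, rfl⟩
    rintro _ ⟨κ, _, S, C, -, rfl⟩
    simp only [bagWidth]
    omega
  have h2 : (Finset.univ.sup fun x => (B x).card) ≤ k + 1 := Finset.sup_le fun x _ => hk x
  simp only [bagWidth] at h1
  omega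

/-! ### Lane systems: the upper bound for the treewidth. -/

/-- `G` consists of `n` hubs, joined among themselves arbitrarily, and of three lanes from each hub.
The lane of type `k` from hub `j` starts in the row of `j` and climbs to row `L`; lanes of equal type
may be joined within a row, and from row `R` on those with consecutive indices are. -/
structure LaneSystem {V : Type*} (G : SimpleGraph V) (n R L : ℕ) where
  hub : Fin n → V
  row : Fin n → ℕ
  lane : Fin 3 → Fin n → ℕ → V
  row_lt : ∀ j, row j < R
  lane_of_le : ∀ k j r, r ≤ row j → lane k j r = hub j
  hub_injective : Function.Injective hub
  lane_ne_hub : ∀ k j r i, row j < r → r ≤ L → lane k j r ≠ hub i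
  lane_inj : ∀ k j r k' j' r', row j < r → r ≤ L → row j' < r' → r' ≤ L →
    lane k j r = lane k' j' r' → k = k' ∧ j = j' ∧ r = r'
  cover : ∀ v, (∃ j, v = hub j) ∨ ∃ k j r, row j < r ∧ r ≤ L ∧ v = lane k j r
  adj_cases : ∀ u v, G.Adj u v → (∃ i j, u = hub i ∧ v = hub j) ∨
    (∃ k j r, r < L ∧ s(u, v) = s(lane k j r, lane k j (r + 1))) ∨
    ∃ k i j r, 0 < r ∧ r ≤ L ∧ s(u, v) = s(lane k i r, lane k j r)
  lane_adj : ∀ k j r, row j ≤ r → r < L → G.Adj (lane k j r) (lane k j (r + 1))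
  rung_adj : ∀ k (i j : Fin n) r, R ≤ r → r ≤ L → (j : ℕ) = i + 1 →
    G.Adj (lane k i r) (lane k j r)

namespace LaneSystem

variable {V : Type*} {G : SimpleGraph V} {n R L : ℕ}

theorem eq_of_lane_eq_lane (S : LaneSystem G n R L) {k k' : Fin 3} {j j' : Fin n} {r r' : ℕ}
    (hr : r ≤ L) (hr' : r' ≤ L) (h : S.lane k j r = S.lane k' j' r') : j = j' := by
  by_cases h1 : S.row j < r <;> by_cases h2 : S.row j' < r'
  · exact (S.lane_inj _ _ _ _ _ _ h1 hr h2 hr' h).2.1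
  · rw [S.lane_of_le k' j' r' (by omega)] at h
    exact absurd h (S.lane_ne_hub _ _ _ _ h1 hr)
  · rw [S.lane_of_le k j r (by omega)] at h
    exact absurd h.symm (S.lane_ne_hub _ _ _ _ h2 hr')
  · rw [S.lane_of_le k j r (by omega), S.lane_of_le k' j' r' (by omega)] at h
    exact S.hub_injective h

theorem eq_of_lane_eq_hub (S : LaneSystem G n R L) {k : Fin 3} {j i : Fin n} {r : ℕ}
    (hr : r ≤ L) (h : S.lane k j r = S.hub i) : j = i ∧ r ≤ S.row j := by
  by_cases h1 : S.row j < r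
  · exact absurd h (S.lane_ne_hub _ _ _ _ h1 hr)
  · refine ⟨S.eq_of_lane_eq_lane (k := k) (k' := k) (r' := 0) hr (Nat.zero_le _) ?_, by omega⟩
    rw [h, S.lane_of_le k i 0 (Nat.zero_le _)]

/-- The parent of a node of the sweeping tree-decomposition. -/
def sweepParent (n L : ℕ) : Option (Fin 3 × Fin L × Fin n) → Option (Fin 3 × Fin L × Fin n)
  | none => none
  | some (k, r, i) =>
    if h : (i : ℕ) + 1 < n then some (k, r, ⟨i + 1, h⟩)
    else if 0 < (r : ℕ) then
      some (k, ⟨r - 1, (Nat.sub_le _ _).trans_lt r.2⟩, ⟨0, (Nat.zero_le _).trans_lt i.2⟩)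
    else none

/-- The number of steps to the root of the sweeping tree-decomposition. -/
def sweepRank (n L : ℕ) : Option (Fin 3 × Fin L × Fin n) → ℕ
  | none => 0
  | some (_, r, i) => r * n + (n - 1 - i) + 1

theorem sweepRank_lt (n L : ℕ) (x : Option (Fin 3 × Fin L × Fin n)) (hx : x ≠ none) :
    sweepRank n L (sweepParent n L x) < sweepRank n L x := by
  match x, hx with
  | some (k, r, i), _ =>
    simp only [sweepParent]
    split_ifs with h1 h2
    · simp only [sweepRank]; omega
    · simp only [sweepRank]
      have hi := i.2
      obtain ⟨m, hm⟩ : ∃ m, (r : ℕ) = m + 1 := ⟨r - 1, by omega⟩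
      rw [hm, Nat.add_sub_cancel, Nat.add_mul]
      omega
    · simp only [sweepRank]; omega

open Classical in
/-- The bags of the sweeping tree-decomposition: the hubs at the root, and on each of three arms the
fronts of the lanes of one type, moved up one at a time. -/
noncomputable def sweepBag (S : LaneSystem G n R L) : Option (Fin 3 × Fin L × Fin n) → Finset V
  | none => Finset.univ.image S.hub
  | some (k, r, i) => (Finset.Iic i).image (fun j => S.lane k j r) ∪
      (Finset.Ici i).image (fun j => S.lane k j (r + 1))

theorem mem_sweepBag_none (S : LaneSystem G n R L) {v : V} :
    v ∈ S.sweepBag none ↔ ∃ j, S.hub j = v := by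
  simp [sweepBag]

theorem mem_sweepBag_some (S : LaneSystem G n R L) {v : V} {k : Fin 3} {r : Fin L} {i : Fin n} :
    v ∈ S.sweepBag (some (k, r, i)) ↔
      ∃ j, (j ≤ i ∧ S.lane k j r = v) ∨ (i ≤ j ∧ S.lane k j (r + 1) = v) := by
  simp [sweepBag, exists_or]

/-- Every lane contributes one vertex except lane `i`, which contributes both ends of the edge along
which the front moves. -/
theorem card_sweepBag_le (S : LaneSystem G n R L) (x : Option (Fin 3 × Fin L × Fin n)) :
    (S.sweepBag x).card ≤ n + 1 := by
  classical
  match x with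
  | none => exact (Finset.card_image_le).trans (by simp)
  | some (k, r, i) =>
    refine (Finset.card_union_le _ _).trans
      ((add_le_add Finset.card_image_le Finset.card_image_le).trans ?_)
    rw [Fin.card_Iic, Fin.card_Ici]
    omega

theorem mem_sweepBag_sweepParent_of_le (S : LaneSystem G n R L) {k : Fin 3} {r : Fin L}
    {i j : Fin n} (hj : j ≤ i) :
    S.lane k j r ∈ S.sweepBag (sweepParent n L (some (k, r, i))) := by
  simp only [sweepParent]
  split_ifs with h1 h2
  · exact S.mem_sweepBag_some.2 ⟨j, Or.inl ⟨hj.trans (Fin.le_def.2 (by simp)), rfl⟩⟩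
  · refine S.mem_sweepBag_some.2 ⟨j, Or.inr ⟨Fin.le_def.2 (by simp), ?_⟩⟩
    congr 1
    simp only
    omega
  -- In row 0 all lanes are still at their hubs, so this front is contained in the root bag.
  · refine S.mem_sweepBag_none.2 ⟨j, (S.lane_of_le _ _ _ ?_).symm⟩
    omega

theorem isTreeDecomposition_sweepBag (S : LaneSystem G n R L) :
    IsTreeDecomposition G (parentGraph none (sweepParent n L)) S.sweepBag := by
  refine isTreeDecomposition_parentGraph (sweepRank_lt n L) ?_ ?_
  · intro u v huv
    have symm2 : ∀ a b : V, s(u, v) = s(a, b) → (∃ x, a ∈ S.sweepBag x ∧ b ∈ S.sweepBag x) →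
        ∃ x, u ∈ S.sweepBag x ∧ v ∈ S.sweepBag x := by
      rintro a b h ⟨x, hx⟩
      rcases Sym2.eq_iff.1 h with ⟨rfl, rfl⟩ | ⟨rfl, rfl⟩
      · exact ⟨x, hx⟩
      · exact ⟨x, hx.symm⟩
    rcases S.adj_cases u v huv with ⟨i, j, rfl, rfl⟩ | ⟨k, j, r, hr, h⟩ | ⟨k, i, j, r, h0, hr, h⟩
    · exact ⟨none, S.mem_sweepBag_none.2 ⟨i, rfl⟩, S.mem_sweepBag_none.2 ⟨j, rfl⟩⟩
    · exact symm2 _ _ h ⟨some (k, ⟨r, hr⟩, j), S.mem_sweepBag_some.2 ⟨j, Or.inl ⟨le_rfl, rfl⟩⟩,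
        S.mem_sweepBag_some.2 ⟨j, Or.inr ⟨le_rfl, rfl⟩⟩⟩
    -- The bag with index 0 contains the whole front in row `m + 1`, hence both ends of any edge
    -- within that row.
    · obtain ⟨m, rfl⟩ : ∃ m, r = m + 1 := ⟨r - 1, by omega⟩
      have hn : 0 < n := (Nat.zero_le _).trans_lt i.2
      have key : ∀ j, S.lane k j (m + 1) ∈ S.sweepBag (some (k, ⟨m, hr⟩, ⟨0, hn⟩)) := fun j =>
        S.mem_sweepBag_some.2 ⟨j, Or.inr ⟨Fin.le_def.2 (Nat.zero_le _), rfl⟩⟩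
      exact symm2 _ _ h ⟨_, key i, key j⟩
  · intro v
    rcases S.cover v with ⟨j, rfl⟩ | ⟨k, j, s, hs, hsL, rfl⟩
    · refine ⟨none, S.mem_sweepBag_none.2 ⟨j, rfl⟩, fun x hx hxt => ⟨hxt, ?_⟩⟩
      match x, hx, hxt with
      | some (k, r, i), hx, _ =>
        have hr := r.2
        obtain ⟨j', ⟨hle, h⟩ | ⟨hle, h⟩⟩ := S.mem_sweepBag_some.1 hx
        · obtain ⟨rfl, -⟩ := S.eq_of_lane_eq_hub hr.le h
          rw [← h]
          exact S.mem_sweepBag_sweepParent_of_le hle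
        · obtain ⟨rfl, hrow⟩ := S.eq_of_lane_eq_hub hr h
          by_cases hij : j' ≤ i
          · rw [← S.lane_of_le k j' r (by omega)]
            exact S.mem_sweepBag_sweepParent_of_le hij
          · have hlt : (i : ℕ) < j' := not_le.1 hij
            have hj := j'.2
            simp only [sweepParent]
            rw [dif_pos (by omega)]
            exact S.mem_sweepBag_some.2 ⟨j', Or.inr ⟨Fin.le_def.2 hlt, h⟩⟩
    · obtain ⟨m, rfl⟩ : ∃ m, s = m + 1 := ⟨s - 1, by omega⟩
      -- A vertex of lane `j` in row `m + 1` lies in bags of row `m` with index at most `j` and of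
      -- row `m + 1` with index at least `j`. Parents have larger index or lower row, so the top is
      -- the node `(k, m, j)`.
      refine ⟨some (k, ⟨m, hsL⟩, j), S.mem_sweepBag_some.2 ⟨j, Or.inr ⟨le_rfl, rfl⟩⟩, ?_⟩
      intro x hx hxt
      match x, hx, hxt with
      | none, hx, _ =>
        obtain ⟨i, hi⟩ := S.mem_sweepBag_none.1 hx
        exact absurd hi.symm (S.lane_ne_hub _ _ _ _ hs hsL)
      | some (k', r, i), hx, hxt =>
        refine ⟨by simp, ?_⟩
        have hr := r.2
        obtain ⟨j', ⟨hle, h⟩ | ⟨hle, h⟩⟩ := S.mem_sweepBag_some.1 hx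
        · rw [← h]
          exact S.mem_sweepBag_sweepParent_of_le hle
        · obtain rfl := S.eq_of_lane_eq_lane hr hsL h
          have hrow : S.row j' < r + 1 := by
            by_contra hcon
            rw [S.lane_of_le k' j' _ (by omega)] at h
            exact S.lane_ne_hub _ _ _ _ hs hsL h.symm
          obtain ⟨rfl, -, hrm⟩ := S.lane_inj _ _ _ _ _ _ hrow hr hs hsL h
          have hij : i ≠ j' := by
            rintro rfl
            refine hxt ?_
            have : r = ⟨m, hsL⟩ := Fin.ext (by simpa using hrm)
            rw [this]
          have hlt : (i : ℕ) < j' := lt_of_le_of_ne hle fun h => hij (Fin.ext h)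
          have hj := j'.2
          simp only [sweepParent]
          rw [dif_pos (by omega)]
          exact S.mem_sweepBag_some.2 ⟨j', Or.inr ⟨Fin.le_def.2 hlt, h⟩⟩

end LaneSystem

theorem LaneSystem.treewidth_le {V : Type} [Finite V] {G : SimpleGraph V} {n R L : ℕ}
    (S : LaneSystem G n R L) : treewidth G ≤ n :=
  _root_.treewidth_le S.isTreeDecomposition_sweepBag S.card_sweepBag_le

/-! ### Lane systems: a bag with almost all hubs. -/

namespace LaneSystem

variable {V : Type*} {G : SimpleGraph V} {n R L : ℕ}

theorem linked_lane (S : LaneSystem G n R L) {X : Set V} {k : Fin 3} {j : Fin n} {a b : ℕ}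
    (ha : S.row j ≤ a) (hab : a ≤ b) (hb : b ≤ L) (hX : ∀ r, a ≤ r → r ≤ b → S.lane k j r ∈ X) :
    Linked G X (S.lane k j a) (S.lane k j b) :=
  Linked.of_chain hab (fun r h1 h2 => S.lane_adj k j r (ha.trans h1) (h2.trans_le hb)) hX

theorem linked_rung (S : LaneSystem G n R L) {X : Set V} {k : Fin 3} {r : ℕ} (hR : R ≤ r)
    (hr : r ≤ L) (hX : ∀ i, S.lane k i r ∈ X) (i j : Fin n) :
    Linked G X (S.lane k i r) (S.lane k j r) := by
  have key : ∀ m (hm : m < n), Linked G X (S.lane k ⟨0, by omega⟩ r) (S.lane k ⟨m, hm⟩ r) := by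
    intro m
    induction m with
    | zero => exact fun _ => Linked.refl (hX _)
    | succ m ih =>
      exact fun hm => (ih (by omega)).trans
        (Linked.of_adj (S.rung_adj k _ _ r hR hr rfl) (hX _) (hX _))
  exact (key i i.2).symm.trans (key j j.2)

variable {ι : Type*} [Finite ι] {T : SimpleGraph ι} {B : ι → Finset V}

/-- Crosses formed by a lane without its hub and one of `m + 1` grid rows pairwise intersect, so
some bag meets them all. If it missed a lane, it would meet all `m + 1` disjoint rows, more than its
size permits. -/
theorem exists_bag_meeting_lanes (S : LaneSystem G n R L) (h : IsTreeDecomposition G T B) {m : ℕ}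
    (hB : ∀ x, (B x).card ≤ m) (hL : R + m ≤ L) (k : Fin 3) :
    ∃ t, ∀ j, ∃ r, S.row j < r ∧ r ≤ L ∧ S.lane k j r ∈ B t := by
  classical
  obtain ⟨t, ht⟩ := h.exists_bag_meeting (κ := Fin n × Fin (m + 1))
    (fun q => {v | (∃ i, v = S.lane k i (R + q.2)) ∨
      ∃ r, S.row q.1 < r ∧ r ≤ L ∧ v = S.lane k q.1 r})
    (by
      rintro ⟨j, s⟩
      have hs := s.2
      have hrow := S.row_lt j
      refine ConnectedIn.of_center (S.lane k j (R + s)) ?_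
      rintro v (⟨i, rfl⟩ | ⟨r, h1, h2, rfl⟩)
      · exact S.linked_rung (by omega) (by omega) (fun i => Or.inl ⟨i, rfl⟩) j i
      · have h1' : S.row j < r := h1
        rcases le_total r (R + s) with hle | hle
        · exact (S.linked_lane h1.le hle (by omega)
            fun q hq _ => Or.inr ⟨q, by show S.row j < q; omega, by omega, rfl⟩).symm
        · exact S.linked_lane (by omega) hle h2
            fun q hq _ => Or.inr ⟨q, by show S.row j < q; omega, by omega, rfl⟩)
    (by
      rintro ⟨i, s⟩ ⟨j, s'⟩
      have hs := s.2
      have hrow := S.row_lt j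
      exact ⟨S.lane k j (R + s), Or.inl ⟨j, rfl⟩, S.lane k j (R + s),
        Or.inr ⟨R + s, by show S.row j < R + s; omega, by omega, rfl⟩, Or.inl rfl⟩)
  refine ⟨t, fun j => ?_⟩
  by_contra hcon
  have hrow : ∀ s : Fin (m + 1), ∃ i, S.lane k i (R + s) ∈ B t := by
    intro s
    obtain ⟨v, ⟨i, rfl⟩ | ⟨r, h1, h2, rfl⟩, hv⟩ := ht (j, s)
    · exact ⟨i, hv⟩
    · exact absurd ⟨r, h1, h2, hv⟩ hcon
  choose f hf using hrow
  have hcard : (Finset.univ : Finset (Fin (m + 1))).card ≤ (B t).card := by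
    refine Finset.card_le_card_of_injOn (fun s => S.lane k (f s) (R + s)) (fun s _ => hf s) ?_
    intro s _ s' _ hss
    have h1 := S.row_lt (f s)
    have h2 := S.row_lt (f s')
    have h3 := s.2
    have h4 := s'.2
    have := (S.lane_inj _ _ _ _ _ _ (by omega) (by omega) (by omega) (by omega) hss).2.2
    exact Fin.ext (by omega)
  have := hB t
  simp at hcard
  omega

/-- A tree-decomposition with bags of size at most `n + c` has a bag that contains all but `c` of the
hubs. -/
theorem exists_bag_hubs (S : LaneSystem G n R L) (h : IsTreeDecomposition G T B) {c : ℕ}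
    (hB : ∀ x, (B x).card ≤ n + c) (hL : R + (n + c) ≤ L) :
    ∃ x, {j | S.hub j ∉ B x}.ncard ≤ c := by
  classical
  choose t ht using S.exists_bag_meeting_lanes h hB hL
  -- The lanes of types `k` and `l` from hub `j`, joined through the hub; the bags at `t k` and `t
  -- l` both meet this set.
  let Y : Fin n → Fin 3 → Fin 3 → Set V := fun j k l =>
    {v | ∃ s, S.row j ≤ s ∧ s ≤ L ∧ (v = S.lane k j s ∨ v = S.lane l j s)}
  have hrow : ∀ j, S.row j ≤ L := fun j => by have := S.row_lt j; omega
  have hlane : ∀ k j, S.lane k j (S.row j) = S.hub j := fun k j => S.lane_of_le k j _ le_rfl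
  have hY : ∀ j k l, ConnectedIn G (Y j k l) := by
    intro j k l
    refine ConnectedIn.of_center (S.hub j) ?_
    rintro v ⟨s, h1, h2, rfl | rfl⟩
    · rw [← hlane k j]
      exact S.linked_lane le_rfl h1 h2 fun r hr hr' => ⟨r, hr, by omega, Or.inl rfl⟩
    · rw [← hlane l j]
      exact S.linked_lane le_rfl h1 h2 fun r hr hr' => ⟨r, hr, by omega, Or.inr rfl⟩
  have hleft : ∀ j k l, t k ∈ hittingNodes B (Y j k l) := by
    intro j k l
    obtain ⟨r, h1, h2, h3⟩ := ht k j
    exact ⟨_, ⟨r, h1.le, h2, Or.inl rfl⟩, h3⟩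
  have hright : ∀ j k l, t l ∈ hittingNodes B (Y j k l) := by
    intro j k l
    obtain ⟨r, h1, h2, h3⟩ := ht l j
    exact ⟨_, ⟨r, h1.le, h2, Or.inr rfl⟩, h3⟩
  obtain ⟨x, hx⟩ := exists_mem_of_pairwise_inter h.isTree
    (F := {Z | ∃ j k l, k ≠ l ∧ Z = hittingNodes B (Y j k l)})
    (by rintro _ ⟨j, k, l, -, rfl⟩; exact h.connectedIn_hittingNodes (hY j k l))
    (by
      rintro _ ⟨j, k, l, hkl, rfl⟩ _ ⟨j', k', l', hkl', rfl⟩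
      -- Two pairs out of three types share a type, and the node `t` of that type lies in both
      -- subtrees.
      have : k = k' ∨ k = l' ∨ l = k' ∨ l = l' := by omega
      rcases this with rfl | rfl | rfl | rfl
      · exact ⟨t k, hleft _ _ _, hleft _ _ _⟩
      · exact ⟨t k, hleft _ _ _, hright _ _ _⟩
      · exact ⟨t l, hright _ _ _, hleft _ _ _⟩
      · exact ⟨t l, hright _ _ _, hright _ _ _⟩)
  have hmeet : ∀ j k l, k ≠ l → ∃ v ∈ Y j k l, v ∈ B x := fun j k l hkl => hx _ ⟨j, k, l, hkl, rfl⟩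
  refine ⟨x, ?_⟩
  let part : Fin n → Finset V := fun j => (B x).filter fun v => ∃ k s, s ≤ L ∧ v = S.lane k j s
  have hdisj : (↑(Finset.univ : Finset (Fin n)) : Set (Fin n)).PairwiseDisjoint part := by
    intro i _ j _ hij
    refine Finset.disjoint_left.2 fun v hv hv' => hij ?_
    obtain ⟨-, k, s, hs, rfl⟩ := Finset.mem_filter.1 hv
    obtain ⟨-, k', s', hs', h'⟩ := Finset.mem_filter.1 hv'
    exact S.eq_of_lane_eq_lane hs hs' h'
  -- If the hub is absent, the bag meets the lanes of every pair of types away from the hub, so it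
  -- misses at most one of the three lanes and contains two vertices.
  have hcard : ∀ j, 1 + (if S.hub j ∉ B x then 1 else 0) ≤ (part j).card := by
    intro j
    by_cases hj : S.hub j ∉ B x
    · rw [if_pos hj]
      have hhit : ∀ k l, k ≠ l → ∃ m s, (m = k ∨ m = l) ∧ S.row j < s ∧ s ≤ L ∧
          S.lane m j s ∈ B x := by
        intro k l hkl
        obtain ⟨v, ⟨s, h1, h2, h3⟩, hv⟩ := hmeet j k l hkl
        have hs : S.row j ≠ s := by
          rintro rfl
          rw [hlane, hlane, or_self] at h3
          exact hj (h3 ▸ hv)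
        rcases h3 with rfl | rfl
        · exact ⟨k, s, Or.inl rfl, by omega, h2, hv⟩
        · exact ⟨l, s, Or.inr rfl, by omega, h2, hv⟩
      obtain ⟨m, s, -, hs, hsL, hms⟩ := hhit 0 1 (by decide)
      -- Modulo 3, `m + 1` and `m + 2` are the two types other than `m`.
      obtain ⟨m', s', hm', hs', hsL', hms'⟩ := hhit (m + 1) (m + 2) (by omega)
      have hmm : m ≠ m' := by omega
      have hne : S.lane m j s ≠ S.lane m' j s' := fun h =>
        hmm (S.lane_inj _ _ _ _ _ _ hs hsL hs' hsL' h).1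
      refine Finset.one_lt_card.2 ⟨_, Finset.mem_filter.2 ⟨hms, m, s, hsL, rfl⟩, _,
        Finset.mem_filter.2 ⟨hms', m', s', hsL', rfl⟩, hne⟩
    · rw [if_neg hj]
      refine Finset.card_pos.2 ⟨S.hub j, Finset.mem_filter.2 ⟨not_not.1 hj, 0, S.row j, hrow j, ?_⟩⟩
      exact (hlane 0 j).symm
  have hsum := Finset.sum_le_sum fun j (_ : j ∈ (Finset.univ : Finset (Fin n))) => hcard j
  rw [← Finset.card_biUnion hdisj, Finset.sum_add_distrib, Finset.sum_boole] at hsum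
  have hsub : (Finset.univ.biUnion part).card ≤ (B x).card :=
    Finset.card_le_card (Finset.biUnion_subset.2 fun j _ => Finset.filter_subset _ _)
  have hBx := hB x
  have : {j | S.hub j ∉ B x} = ↑(Finset.univ.filter fun j => S.hub j ∉ B x) := by ext; simp
  rw [this, Set.ncard_coe_finset]
  simp at hsum
  omega

end LaneSystem

/-! ### Topological minors: construction from paths, and complete minors as lower bounds for
treewidth. -/

theorem exists_walk_coe {V : Type*} {G : SimpleGraph V} (K : G.Subgraph) {a b : V}
    (p : G.Walk a b) (ha : a ∈ K.verts) (hb : b ∈ K.verts)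
    (hp : ∀ x y, s(x, y) ∈ p.edges → K.Adj x y) :
    ∃ q : K.coe.Walk ⟨a, ha⟩ ⟨b, hb⟩, q.support.map Subtype.val = p.support ∧
      q.edges.map (Sym2.map Subtype.val) = p.edges := by
  induction p with
  | nil => exact ⟨.nil, by simp, by simp⟩
  | @cons a w b hadj p ih =>
    have h : K.Adj a w := hp a w (by simp)
    obtain ⟨q, hq, hq'⟩ := ih (K.edge_vert h.symm) hb fun x y hxy => hp x y (by simp [hxy])
    have h' : K.coe.Adj ⟨a, ha⟩ ⟨w, K.edge_vert h.symm⟩ := h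
    exact ⟨.cons h' q, by simp [hq], by simp [hq']⟩

/-- A family of internally disjoint paths in `G` between distinct vertices, one for each edge of `H`,
makes `H` a topological minor of `G`. -/
theorem isTopologicalMinor_of_paths {U V : Type*} {H : SimpleGraph U} {G : SimpleGraph V}
    (φ : U ↪ V) (P : ∀ u v : U, H.Adj u v → G.Walk (φ u) (φ v))
    (hpath : ∀ u v (h : H.Adj u v), (P u v h).IsPath)
    (hrev : ∀ u v (h : H.Adj u v), P v u h.symm = (P u v h).reverse)
    (hbranch : ∀ u v (h : H.Adj u v) (w : U), φ w ∈ (P u v h).support → w = u ∨ w = v)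
    (hdisj : ∀ u v (h : H.Adj u v) u' v' (h' : H.Adj u' v'), s(u, v) ≠ s(u', v') →
      ∀ x, x ∈ (P u v h).support → x ∈ (P u' v' h').support → x ∈ Set.range φ) :
    IsTopologicalMinor H G := by
  let K : G.Subgraph :=
    { verts := {x | x ∈ Set.range φ ∨ ∃ u v, ∃ h : H.Adj u v, x ∈ (P u v h).support}
      Adj := fun x y => ∃ u v, ∃ h : H.Adj u v, s(x, y) ∈ (P u v h).edges
      adj_sub := by
        rintro x y ⟨u, v, h, hxy⟩
        exact (P u v h).adj_of_mem_edges hxy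
      edge_vert := by
        rintro x y ⟨u, v, h, hxy⟩
        exact Or.inr ⟨u, v, h, (P u v h).fst_mem_support_of_mem_edges hxy⟩
      symm := ⟨by
        rintro x y ⟨u, v, h, hxy⟩
        exact ⟨u, v, h, by rwa [Sym2.eq_swap]⟩⟩ }
  have hφ : ∀ u, φ u ∈ K.verts := fun u => Or.inl ⟨u, rfl⟩
  choose Q hQs hQe using fun u v (h : H.Adj u v) =>
    exists_walk_coe K (P u v h) (hφ u) (hφ v) fun x y hxy => ⟨u, v, h, hxy⟩
  have hmem : ∀ u v (h : H.Adj u v) (x : K.verts), x ∈ (Q u v h).support ↔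
      (x : V) ∈ (P u v h).support := by
    intro u v h x
    rw [← hQs, List.mem_map]
    constructor
    · exact fun hx => ⟨x, hx, rfl⟩
    · rintro ⟨y, hy, hyx⟩
      rwa [← Subtype.ext hyx]
  let ψ : U ↪ K.verts := ⟨fun u => ⟨φ u, hφ u⟩, fun u v huv => φ.injective (congrArg Subtype.val huv)⟩
  have hrange : ∀ x : K.verts, x ∈ Set.range ψ ↔ (x : V) ∈ Set.range φ := by
    intro x
    constructor
    · rintro ⟨u, rfl⟩; exact ⟨u, rfl⟩
    · rintro ⟨u, hu⟩; exact ⟨u, Subtype.ext hu⟩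
  refine ⟨K, ψ, Q, ?_, ?_, ?_, ?_, ?_, ?_⟩
  · intro u v h
    have := (hpath u v h).support_nodup
    rw [← hQs] at this
    exact (SimpleGraph.Walk.isPath_def _).2 (List.Nodup.of_map _ this)
  · intro u v h
    refine SimpleGraph.Walk.ext_support (List.map_injective_iff.2 Subtype.val_injective ?_)
    rw [SimpleGraph.Walk.support_reverse, List.map_reverse]
    exact (hQs v u h.symm).trans
      ((congrArg SimpleGraph.Walk.support (hrev u v h)).trans
        ((SimpleGraph.Walk.support_reverse _).trans (congrArg List.reverse (hQs u v h).symm)))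
  · intro u v h w hw
    exact hbranch u v h w ((hmem u v h (ψ w)).1 hw)
  · intro u v h u' v' h' hne x hx hx'
    exact (hrange x).2 (hdisj u v h u' v' h' hne x ((hmem _ _ _ x).1 hx) ((hmem _ _ _ x).1 hx'))
  · rintro ⟨x, hx | ⟨u, v, h, hx⟩⟩
    · exact Or.inl ((hrange _).2 hx)
    · exact Or.inr ⟨u, v, h, (hmem u v h _).2 hx⟩
  · rintro ⟨x, hx⟩ ⟨y, hy⟩ ⟨u, v, h, hxy⟩
    refine ⟨u, v, h, ?_⟩
    rw [← hQe, List.mem_map] at hxy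
    obtain ⟨e, he, hexy⟩ := hxy
    have : e = s(⟨x, hx⟩, ⟨y, hy⟩) :=
      Sym2.map.injective Subtype.val_injective hexy
    rwa [← this]

/-- The walk along a sequence of consecutively adjacent vertices. -/
def chainWalk {V : Type*} {G : SimpleGraph V} (a : ℕ → V) :
    ∀ m : ℕ, (∀ r < m, G.Adj (a r) (a (r + 1))) → G.Walk (a 0) (a m)
  | 0, _ => .nil
  | m + 1, h => (chainWalk a m fun r hr => h r (hr.trans (Nat.lt_succ_self m))).concat
      (h m (Nat.lt_succ_self m))

theorem support_chainWalk {V : Type*} {G : SimpleGraph V} (a : ℕ → V) :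
    ∀ (m : ℕ) (h : ∀ r < m, G.Adj (a r) (a (r + 1))),
      (chainWalk a m h).support = (List.range (m + 1)).map a
  | 0, _ => by simp [chainWalk]
  | m + 1, h => by
    rw [chainWalk, SimpleGraph.Walk.support_concat, support_chainWalk a m, List.range_succ (n := m + 1)]
    simp

theorem mem_support_chainWalk {V : Type*} {G : SimpleGraph V} {a : ℕ → V} {m : ℕ}
    {h : ∀ r < m, G.Adj (a r) (a (r + 1))} {x : V} :
    x ∈ (chainWalk a m h).support ↔ ∃ r ≤ m, a r = x := by
  simp [support_chainWalk]

/-- A graph is a topological minor if its edges `uv` are represented by disjoint strands of equal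
length from `u` and `v` whose last vertices are adjacent. -/
theorem isTopologicalMinor_of_strands {U V : Type*} (H : SimpleGraph U) {G : SimpleGraph V}
    (a : U → U → ℕ → V) (φ : U → V) (t : U → U → ℕ)
    (hzero : ∀ u v, a u v 0 = φ u)
    (hstrand : ∀ u v, H.Adj u v → ∀ r < t u v, G.Adj (a u v r) (a u v (r + 1)))
    (hcap : ∀ u v, H.Adj u v → G.Adj (a u v (t u v)) (a v u (t v u)))
    (hφ : Function.Injective φ)
    (hbranch : ∀ u v r w, H.Adj u v → r ≤ t u v → a u v r = φ w → w = u)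
    (hinj : ∀ u v r u' v' r', H.Adj u v → H.Adj u' v' → r ≤ t u v → r' ≤ t u' v' →
      a u v r = a u' v' r' → u = u' ∧ r = r' ∧ (v = v' ∨ r = 0)) :
    IsTopologicalMinor H G := by
  let A : ∀ u v, H.Adj u v → G.Walk (φ u) (a u v (t u v)) := fun u v h =>
    (chainWalk (a u v) (t u v) (hstrand u v h)).copy (hzero u v) rfl
  let P : ∀ u v, H.Adj u v → G.Walk (φ u) (φ v) := fun u v h =>
    (A u v h).append (.cons (hcap u v h) (A v u h.symm).reverse)
  have hA : ∀ u v h x, x ∈ (A u v h).support ↔ ∃ r ≤ t u v, a u v r = x := by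
    intro u v h x
    simp only [A, SimpleGraph.Walk.support_copy]
    exact mem_support_chainWalk
  have hP : ∀ u v h x, x ∈ (P u v h).support ↔
      (∃ r ≤ t u v, a u v r = x) ∨ ∃ r ≤ t v u, a v u r = x := by
    intro u v h x
    rw [← hA u v h, ← hA v u h.symm]
    simp only [P, SimpleGraph.Walk.mem_support_append_iff, SimpleGraph.Walk.support_cons,
      List.mem_cons, SimpleGraph.Walk.support_reverse, List.mem_reverse]
    constructor
    · rintro (h1 | rfl | h1)
      · exact Or.inl h1
      · exact Or.inl (A u v h).end_mem_support
      · exact Or.inr h1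
    · rintro (h1 | h1)
      · exact Or.inl h1
      · exact Or.inr (Or.inr h1)
  have hApath : ∀ u v h, (A u v h).support.Nodup := by
    intro u v h
    simp only [A, SimpleGraph.Walk.support_copy, support_chainWalk]
    refine List.Nodup.map_on ?_ List.nodup_range
    intro r hr s hs hrs
    exact (hinj u v r u v s h h (by simpa [Nat.lt_succ_iff] using hr)
      (by simpa [Nat.lt_succ_iff] using hs) hrs).2.1
  refine isTopologicalMinor_of_paths ⟨φ, hφ⟩ P ?_ ?_ ?_ ?_
  · intro u v h
    rw [SimpleGraph.Walk.isPath_def]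
    simp only [P, SimpleGraph.Walk.support_append, SimpleGraph.Walk.support_cons, List.tail_cons,
      SimpleGraph.Walk.support_reverse]
    rw [List.nodup_append']
    refine ⟨hApath u v h, List.nodup_reverse.2 (hApath v u h.symm), ?_⟩
    intro x hx hx'
    rw [List.mem_reverse] at hx'
    obtain ⟨r, hr, rfl⟩ := (hA u v h x).1 hx
    obtain ⟨s, hs, hrs⟩ := (hA v u h.symm _).1 hx'
    exact h.ne (hinj _ _ _ _ _ _ h.symm h hs hr hrs).1.symm
  · intro u v h
    simp only [P, SimpleGraph.Walk.reverse_append, SimpleGraph.Walk.reverse_cons,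
      SimpleGraph.Walk.reverse_reverse]
    rw [← SimpleGraph.Walk.append_assoc]
    simp
  · intro u v h w hw
    rcases (hP u v h _).1 hw with ⟨r, hr, hrw⟩ | ⟨r, hr, hrw⟩
    · exact Or.inl (hbranch u v r w h hr hrw)
    · exact Or.inr (hbranch v u r w h.symm hr hrw)
  -- A vertex common to two strands is on the same strand or has `r = 0`; the first is excluded for
  -- different edges, and in the second the vertex is a branch vertex.
  · have key : ∀ u v, H.Adj u v → ∀ u' v', H.Adj u' v' → s(u, v) ≠ s(u', v') → ∀ r ≤ t u v,
        ∀ r' ≤ t u' v', a u v r = a u' v' r' → a u v r ∈ Set.range φ := by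
      intro u v h u' v' h' hne r hr r' hr' heq
      obtain ⟨rfl, rfl, rfl | rfl⟩ := hinj u v r u' v' r' h h' hr hr' heq
      · exact absurd rfl hne
      · exact ⟨u, (hzero u v).symm⟩
    intro u v h u' v' h' hne x hx hx'
    rcases (hP u v h x).1 hx with ⟨r, hr, rfl⟩ | ⟨r, hr, rfl⟩ <;>
      rcases (hP u' v' h' _).1 hx' with ⟨r', hr', heq⟩ | ⟨r', hr', heq⟩
    · exact key u v h u' v' h' hne r hr r' hr' heq.symm
    · exact key u v h v' u' h'.symm (by rwa [Sym2.eq_swap (a := v')]) r hr r' hr' heq.symm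
    · exact key v u h.symm u' v' h' (by rwa [Sym2.eq_swap (a := v)]) r hr r' hr' heq.symm
    · exact key v u h.symm v' u' h'.symm
        (by rwa [Sym2.eq_swap (a := v), Sym2.eq_swap (a := v')]) r hr r' hr' heq.symm

theorem Linked.image_subgraph {V : Type*} {G : SimpleGraph V} {K : G.Subgraph} {X : Set K.verts}
    {x y : K.verts} (h : Linked K.coe X x y) :
    Linked G (Subtype.val '' X) (x : V) (y : V) := by
  obtain ⟨p, hp⟩ := h
  induction p with
  | nil => exact .refl ⟨_, hp _ (by simp), rfl⟩
  | @cons u v _ hadj p ih =>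
    have hadj' : G.Adj u v := K.adj_sub hadj
    have hv : v ∈ X := hp v (by simp)
    exact (Linked.of_adj (X := Subtype.val '' X) hadj' ⟨u, hp u (by simp), rfl⟩ ⟨v, hv, rfl⟩).trans
      (ih fun z hz => hp z (by simp [hz]))

/-- The branch sets of a complete graph in a subdivision of it. -/
theorem exists_branchSets {m : ℕ} {W : Type*} {K : SimpleGraph W}
    (h : IsSubdivision (⊤ : SimpleGraph (Fin m)) K) :
    ∃ M : Fin m → Set W, (∀ u, (M u).Nonempty) ∧ (∀ u, ConnectedIn K (M u)) ∧
      (∀ u v, u ≠ v → Disjoint (M u) (M v)) ∧ ∀ u v, u < v → ∃ x ∈ M u, ∃ y ∈ M v, K.Adj x y := by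
  classical
  obtain ⟨φ, P, hpath, -, hbranch, hdisj, -, -⟩ := h
  -- The interior of each path goes to its smaller end, so that the last edge of the path joins the
  -- two branch sets.
  let M : Fin m → Set W := fun u =>
    {x | x = φ u ∨ ∃ v, ∃ h : u < v, x ∈ (P u v h.ne).support ∧ x ≠ φ v}
  have hφM : ∀ u, φ u ∈ M u := fun u => Or.inl rfl
  refine ⟨M, fun u => ⟨_, hφM u⟩, fun u => ?_, fun u v huv => ?_, fun u v huv => ?_⟩
  · refine ConnectedIn.of_center (φ u) ?_
    rintro x (rfl | ⟨v, huv, hx, hxv⟩)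
    · exact .refl (hφM u)
    · refine ⟨(P u v huv.ne).takeUntil x hx, fun z hz => Or.inr ⟨v, huv, ?_, ?_⟩⟩
      · exact SimpleGraph.Walk.support_takeUntil_subset_support _ hx hz
      · rintro rfl
        exact SimpleGraph.Walk.endpoint_notMem_support_takeUntil (hpath u v huv.ne) hx hxv.symm hz
  · refine Set.disjoint_left.2 ?_
    rintro x (rfl | ⟨w, huw, hx, hxw⟩) (hx' | ⟨w', hvw', hx', hxw'⟩)
    · exact huv (φ.injective hx')
    · rcases hbranch _ _ _ _ hx' with rfl | rfl
      · exact huv rfl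
      · exact hxw' rfl
    · subst hx'
      rcases hbranch _ _ _ _ hx with rfl | rfl
      · exact huv rfl
      · exact hxw rfl
    · by_cases heq : s(u, w) = s(v, w')
      · rcases Sym2.eq_iff.1 heq with ⟨rfl, rfl⟩ | ⟨rfl, rfl⟩
        · exact huv rfl
        · exact lt_asymm huw hvw'
      · obtain ⟨z, rfl⟩ := hdisj _ _ _ _ _ _ heq x hx hx'
        rcases hbranch _ _ _ _ hx with rfl | rfl
        · rcases hbranch _ _ _ _ hx' with rfl | rfl
          · exact huv rfl
          · exact hxw' rfl
        · exact hxw rfl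
  · have hnil : ¬ (P u v huv.ne).Nil := SimpleGraph.Walk.not_nil_of_ne fun h => huv.ne (φ.injective h)
    have hadj := (P u v huv.ne).adj_penultimate hnil
    exact ⟨_, Or.inr ⟨v, huv, SimpleGraph.Walk.getVert_mem_support _ _, hadj.ne⟩, _, hφM v, hadj⟩

/-- The branch sets are connected and pairwise adjacent, so one bag meets all of them; they are
disjoint, so this bag has at least `m` vertices. -/
theorem le_treewidth_of_isTopologicalMinor {m : ℕ} {V : Type} [Finite V] {G : SimpleGraph V}
    (h : IsTopologicalMinor (⊤ : SimpleGraph (Fin m)) G) : (m : ℤ) - 1 ≤ treewidth G := by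
  classical
  have := Fintype.ofFinite V
  obtain ⟨K, hK⟩ := h
  obtain ⟨M, hne, hconn, hdisj, hadj⟩ := exists_branchSets hK
  -- The one-bag decomposition shows that the set of widths is non-empty.
  refine le_csInf ⟨_, Unit, inferInstance, ⊥, fun _ => Finset.univ, ⟨?_, ?_, ?_⟩, rfl⟩ ?_
  · exact SimpleGraph.IsTree.of_subsingleton
  · exact fun v w _ => ⟨(), by simp⟩
  · intro v
    exact induce_connected_of_center (c := ()) (by simp) fun x hx => .refl hx
  · rintro _ ⟨ι, _, T, B, hT, rfl⟩
    obtain ⟨t, ht⟩ := hT.exists_bag_meeting (fun u => Subtype.val '' M u)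
      (by
        rintro u _ ⟨x, hx, rfl⟩ _ ⟨y, hy, rfl⟩
        exact (hconn u x hx y hy).image_subgraph)
      (by
        intro u v
        rcases lt_trichotomy u v with huv | rfl | huv
        · obtain ⟨x, hx, y, hy, hxy⟩ := hadj u v huv
          exact ⟨x, ⟨x, hx, rfl⟩, y, ⟨y, hy, rfl⟩, Or.inr (K.adj_sub hxy)⟩
        · obtain ⟨x, hx⟩ := hne u
          exact ⟨x, ⟨x, hx, rfl⟩, x, ⟨x, hx, rfl⟩, Or.inl rfl⟩
        · obtain ⟨x, hx, y, hy, hxy⟩ := hadj v u huv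
          exact ⟨y, ⟨y, hy, rfl⟩, x, ⟨x, hx, rfl⟩, Or.inr (K.adj_sub hxy).symm⟩)
    choose f hf hfB using ht
    have hcard : (Finset.univ : Finset (Fin m)).card ≤ (B t).card := by
      refine Finset.card_le_card_of_injOn f (fun u _ => hfB u) ?_
      intro u _ v _ huv
      by_contra hne'
      obtain ⟨x, hx, hxu⟩ := hf u
      obtain ⟨y, hy, hyv⟩ := hf v
      have hxy : x = y := Subtype.ext (hxu.trans (huv.trans hyv.symm))
      exact Set.disjoint_left.1 (hdisj u v hne') hx (hxy ▸ hy)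
    have hsup : (B t).card ≤ Finset.univ.sup fun x => (B x).card :=
      Finset.le_sup (f := fun x => (B x).card) (Finset.mem_univ t)
    simp only [Finset.card_univ, Fintype.card_fin] at hcard
    simp only [bagWidth]
    omega

/-! ### Words describing the rows of the drawing, and steps between them. -/

/-- A strand carrying hubs: the root of a branch vertex, or the strand from `u` towards `v`. -/
abbrev Carrier (N : ℕ) := Fin N ⊕ (Fin N × Fin N)

/-- A letter is a carrier or a link: the link `((a, r), k)` is the one of type `k` that leaves
the hub of the carrier `a` in row `r`. -/
abbrev Letter (N : ℕ) := Carrier N ⊕ ((Carrier N × ℕ) × Fin 3)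

/-- The letter of row `r` from which a letter of row `r + 1` continues. -/
def parentLetter {N : ℕ} (r : ℕ) : Letter N → Letter N
  | .inl (.inl u) => .inl (.inl u)
  | .inl (.inr (u, v)) => if r = 0 then .inl (.inl u) else .inl (.inr (u, v))
  | .inr ((a, s), k) => if s = r then .inl a else .inr ((a, s), k)

/-- The links that a letter sends out. -/
def trail {N : ℕ} (r : ℕ) : Letter N → List (Letter N)
  | .inl a => (List.finRange 3).map fun k => .inr ((a, r), k)
  | .inr _ => []

/-- A letter together with the links that it sends out to the left. -/
def spreadLeft {N : ℕ} (r : ℕ) (σ : Letter N) : List (Letter N) := trail r σ ++ [σ]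

/-- A letter together with the links that it sends out to the right. -/
def spreadRight {N : ℕ} (r : ℕ) (σ : Letter N) : List (Letter N) := σ :: trail r σ

/-- The word `v` of row `r + 1` is a planar continuation of the word `w` of row `r`. -/
inductive Spread {N : ℕ} (r : ℕ) : List (Letter N) → List (Letter N) → Prop
  | nil : Spread r [] []
  | cons {a l w v} (hpar : ∀ b ∈ l, parentLetter r b = a) (hnodup : l.Nodup) (h : Spread r w v) :
      Spread r (a :: w) (l ++ v)

namespace Spread

variable {N r : ℕ}

theorem append {w w' v v' : List (Letter N)} (h : Spread r w v) (h' : Spread r w' v') :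
    Spread r (w ++ w') (v ++ v') := by
  induction h with
  | nil => exact h'
  | cons hpar hnodup _ ih => rw [List.cons_append, List.append_assoc]; exact .cons hpar hnodup ih

theorem flatMap (f : Letter N → List (Letter N)) {w : List (Letter N)}
    (hpar : ∀ a ∈ w, ∀ b ∈ f a, parentLetter r b = a) (hnodup : ∀ a ∈ w, (f a).Nodup) :
    Spread r w (w.flatMap f) := by
  induction w with
  | nil => exact .nil
  | cons a w ih =>
    rw [List.flatMap_cons]
    exact .cons (hpar a (by simp)) (hnodup a (by simp))
      (ih (fun b hb => hpar b (by simp [hb])) fun b hb => hnodup b (by simp [hb]))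

theorem parent_mem {w v : List (Letter N)} (h : Spread r w v) :
    ∀ b ∈ v, parentLetter r b ∈ w := by
  induction h with
  | nil => simp
  | cons hpar _ _ ih =>
    intro b hb
    rcases List.mem_append.1 hb with hb | hb
    · simp [hpar b hb]
    · exact List.mem_cons_of_mem _ (ih b hb)

theorem nodup {w v : List (Letter N)} (h : Spread r w v) (hw : w.Nodup) : v.Nodup := by
  induction h with
  | nil => exact List.nodup_nil
  | cons hpar hnodup h ih =>
    rw [List.nodup_cons] at hw
    refine List.nodup_append'.2 ⟨hnodup, ih hw.2, fun b hb hb' => hw.1 ?_⟩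
    rw [← hpar b hb]
    exact h.parent_mem b hb'

/-- Planarity of the continuation: the children appear in the order of their parents. The function
`κ` will be the place in `w`. -/
theorem pairwise {w v : List (Letter N)} (h : Spread r w v) (κ : Letter N → ℕ)
    (hw : w.Pairwise fun a b => κ a ≤ κ b) :
    v.Pairwise fun a b => κ (parentLetter r a) ≤ κ (parentLetter r b) := by
  induction h with
  | nil => exact List.Pairwise.nil
  | cons hpar _ h ih =>
    rw [List.pairwise_cons] at hw
    refine List.pairwise_append.2 ⟨?_, ih hw.2, fun b hb c hc => ?_⟩
    · exact List.pairwise_iff_forall_sublist.2 fun hs => by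
        rw [hpar _ (hs.subset (by simp)), hpar _ (hs.subset (by simp))]
    · rw [hpar b hb]
      exact hw.1 _ (h.parent_mem c hc)

end Spread

/-- The position of a letter in a word. -/
def place {α : Type*} [DecidableEq α] (w : List α) (a : α) : ℕ := w.idxOf a

section place

variable {α : Type*} [DecidableEq α] {w : List α} {a b : α}

theorem eq_of_place_eq (ha : a ∈ w) (h : place w a = place w b) : a = b :=
  (List.idxOf_inj ha).1 h

theorem place_getElem (hw : w.Nodup) {i : ℕ} (hi : i < w.length) : place w w[i] = i :=
  hw.idxOf_getElem i hi

theorem place_lt_length (ha : a ∈ w) : place w a < w.length := List.idxOf_lt_length_of_mem ha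

theorem getElem_place (ha : a ∈ w) : w[place w a]'(place_lt_length ha) = a :=
  List.getElem_idxOf _

theorem pairwise_place_le (hw : w.Nodup) : w.Pairwise fun a b => place w a ≤ place w b := by
  rw [List.pairwise_iff_getElem]
  intro i j hi hj hij
  rw [place_getElem hw, place_getElem hw]
  exact hij.le

theorem rel_of_place_lt {p : α → α → Prop} (hp : w.Pairwise p) (ha : a ∈ w) (hb : b ∈ w)
    (h : place w a < place w b) : p a b := by
  have := List.pairwise_iff_getElem.1 hp _ _ (place_lt_length ha) (place_lt_length hb) h
  rwa [getElem_place ha, getElem_place hb] at this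

theorem place_append_cons {x z : List α} (h : a ∉ x) : place (x ++ a :: z) a = x.length := by
  rw [place, List.idxOf_append_of_notMem h, List.idxOf_cons_self, Nat.add_zero]

end place

/-- Between the words of rows `r` and `r + 1` at most one pair of strands crosses. -/
def AtMostOneCrossing {N : ℕ} (r : ℕ) (w w' : List (Letter N)) : Prop :=
  ∃ p : Option (Letter N × Letter N), w'.Pairwise fun a b =>
    place w (parentLetter r a) ≤ place w (parentLetter r b) ∨ p = some (a, b)

theorem Spread.atMostOneCrossing {N r : ℕ} {w v : List (Letter N)} (h : Spread r w v)
    (hw : w.Nodup) : AtMostOneCrossing r w v :=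
  ⟨none, (h.pairwise _ (pairwise_place_le hw)).imp fun h => Or.inl h⟩

/-- Transposing two neighbours in a planar continuation changes the relative order of this pair
alone. -/
theorem Spread.atMostOneCrossing_swap {N r : ℕ} {w v₁ v₂ : List (Letter N)} {s t : Letter N}
    (h : Spread r w (v₁ ++ s :: t :: v₂)) (hw : w.Nodup) :
    AtMostOneCrossing r w (v₁ ++ t :: s :: v₂) := by
  refine ⟨some (t, s), ?_⟩
  have hp := h.pairwise _ (pairwise_place_le hw)
  simp only [List.pairwise_append, List.pairwise_cons, List.mem_cons] at hp ⊢
  obtain ⟨h1, ⟨h2, h3, h4⟩, h5⟩ := hp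
  refine ⟨h1.imp fun h => Or.inl h, ⟨?_, ?_, h4.imp fun h => Or.inl h⟩, ?_⟩
  · rintro b (rfl | hb)
    · exact Or.inr rfl
    · exact Or.inl (h3 b hb)
  · exact fun b hb => Or.inl (h2 b (Or.inr hb))
  · rintro a ha b (rfl | rfl | hb)
    · exact Or.inl (h5 a ha _ (Or.inr (Or.inl rfl)))
    · exact Or.inl (h5 a ha _ (Or.inl rfl))
    · exact Or.inl (h5 a ha _ (Or.inr (Or.inr hb)))

/-- The strands present come in pairs `(u, v)`, `(v, u)`. -/
def PairedStrands {N : ℕ} (w : List (Letter N)) : Prop :=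
  ∀ a, .inl a ∈ w → ∃ u v, a = .inr (u, v) ∧ u ≠ v ∧ .inl (.inr (v, u)) ∈ w

/-- The word `w'` of row `r + 1` is an admissible continuation of the word `w` of row `r`. -/
structure IsStep {N : ℕ} (r : ℕ) (w w' : List (Letter N)) : Prop where
  nodup : w'.Nodup
  atMostOneCrossing : AtMostOneCrossing r w w'
  link_mem : ∀ l, .inr l ∈ w → .inr l ∈ w'
  emit_mem : ∀ a k, .inl a ∈ w → .inr ((a, r), k) ∈ w'
  parent_mem : ∀ σ ∈ w', parentLetter r σ ∈ w
  adjacent_of_notMem : ∀ u v, .inl (.inr (u, v)) ∈ w → .inl (.inr (u, v)) ∉ w' →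
    place w (.inl (.inr (u, v))) = place w (.inl (.inr (v, u))) + 1 ∨
      place w (.inl (.inr (v, u))) = place w (.inl (.inr (u, v))) + 1
  pairedStrands : PairedStrands w'

/-- The condition on the word `w` of row `r` that all steps preserve. -/
structure IsWord {N : ℕ} (r : ℕ) (w : List (Letter N)) : Prop where
  pos : 0 < r
  nodup : w.Nodup
  lt_of_link_mem : ∀ a s k, .inr ((a, s), k) ∈ w → s < r
  pairedStrands : PairedStrands w

theorem IsStep.isWord {N r : ℕ} {w w' : List (Letter N)} (h : IsStep r w w') (hw : IsWord r w) :
    IsWord (r + 1) w' where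
  pos := Nat.succ_pos r
  nodup := h.nodup
  lt_of_link_mem a s k hl := by
    have := h.parent_mem _ hl
    simp only [parentLetter] at this
    split_ifs at this with hs
    · omega
    · exact (hw.lt_of_link_mem _ _ _ this).trans (Nat.lt_succ_self r)
  pairedStrands := h.pairedStrands

theorem mem_trail {N r : ℕ} {σ b : Letter N} :
    b ∈ trail r σ ↔ ∃ a k, σ = .inl a ∧ b = .inr ((a, r), k) := by
  rcases σ with a | l
  · simp only [trail, List.mem_map, List.mem_finRange, true_and, Sum.inl.injEq]
    constructor
    · rintro ⟨k, rfl⟩; exact ⟨a, k, rfl, rfl⟩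
    · rintro ⟨a', k, rfl, rfl⟩; exact ⟨k, rfl⟩
  · simp [trail]

theorem parentLetter_of_mem_trail {N r : ℕ} {σ b : Letter N} (h : b ∈ trail r σ) :
    parentLetter r b = σ := by
  obtain ⟨a, k, rfl, rfl⟩ := mem_trail.1 h
  simp [parentLetter]

theorem nodup_trail {N r : ℕ} (σ : Letter N) : (trail r σ).Nodup := by
  rcases σ with a | l
  · refine (List.nodup_finRange 3).map fun k k' h => ?_
    simpa using h
  · exact List.nodup_nil

theorem mem_flatMap_spreadLeft {N r : ℕ} {σ : Letter N} {x : List (Letter N)} (h : σ ∈ x) :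
    σ ∈ x.flatMap (spreadLeft r) :=
  List.mem_flatMap.2 ⟨σ, h, List.mem_append_right _ (List.mem_singleton_self σ)⟩

theorem mem_flatMap_spreadRight {N r : ℕ} {σ : Letter N} {x : List (Letter N)} (h : σ ∈ x) :
    σ ∈ x.flatMap (spreadRight r) :=
  List.mem_flatMap.2 ⟨σ, h, List.mem_cons_self⟩

theorem inl_notMem_trail {N r : ℕ} {σ : Letter N} {a : Carrier N} : .inl a ∉ trail r σ := by
  intro h
  obtain ⟨_, _, -, h⟩ := mem_trail.1 h
  exact Sum.inl_ne_inr h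

theorem inl_mem_of_mem_flatMap_spreadLeft {N r : ℕ} {a : Carrier N} {x : List (Letter N)}
    (h : .inl a ∈ x.flatMap (spreadLeft r)) : .inl a ∈ x := by
  obtain ⟨σ, hσ, h⟩ := List.mem_flatMap.1 h
  rcases List.mem_append.1 h with h | h
  · exact absurd h inl_notMem_trail
  · rwa [List.mem_singleton.1 h]

theorem inl_mem_of_mem_flatMap_spreadRight {N r : ℕ} {a : Carrier N} {x : List (Letter N)}
    (h : .inl a ∈ x.flatMap (spreadRight r)) : .inl a ∈ x := by
  obtain ⟨σ, hσ, h⟩ := List.mem_flatMap.1 h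
  rcases List.mem_cons.1 h with h | h
  · rwa [h]
  · exact absurd h inl_notMem_trail

namespace IsWord

variable {N r : ℕ} {w : List (Letter N)}

/-- Above row 0 every old letter continues itself; only links that start in the current row have a
different parent. -/
theorem parentLetter_eq (h : IsWord r w) {σ : Letter N} (hσ : σ ∈ w) : parentLetter r σ = σ := by
  have hr := h.pos
  rcases σ with (u | ⟨u, v⟩) | ⟨⟨a, s⟩, k⟩
  · rfl
  · simp only [parentLetter, if_neg hr.ne']
  · simp only [parentLetter, if_neg (h.lt_of_link_mem _ _ _ hσ).ne]

theorem notMem_trail (h : IsWord r w) {σ τ : Letter N} (hσ : σ ∈ w) : σ ∉ trail r τ := by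
  intro hmem
  obtain ⟨a, k, -, rfl⟩ := mem_trail.1 hmem
  exact lt_irrefl _ (h.lt_of_link_mem _ _ _ hσ)

theorem parentLetter_of_mem_spreadLeft (h : IsWord r w) {σ : Letter N} (hσ : σ ∈ w) :
    ∀ b ∈ spreadLeft r σ, parentLetter r b = σ := by
  intro b hb
  rcases List.mem_append.1 hb with hb | hb
  · exact parentLetter_of_mem_trail hb
  · rw [List.mem_singleton.1 hb, h.parentLetter_eq hσ]

theorem parentLetter_of_mem_spreadRight (h : IsWord r w) {σ : Letter N} (hσ : σ ∈ w) :
    ∀ b ∈ spreadRight r σ, parentLetter r b = σ := by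
  intro b hb
  rcases List.mem_cons.1 hb with rfl | hb
  · exact h.parentLetter_eq hσ
  · exact parentLetter_of_mem_trail hb

theorem nodup_spreadLeft (h : IsWord r w) {σ : Letter N} (hσ : σ ∈ w) :
    (spreadLeft r σ).Nodup := by
  refine List.nodup_append'.2 ⟨nodup_trail σ, List.nodup_singleton σ, fun b hb hb' => ?_⟩
  rw [List.mem_singleton.1 hb'] at hb
  exact h.notMem_trail hσ hb

theorem nodup_spreadRight (h : IsWord r w) {σ : Letter N} (hσ : σ ∈ w) :
    (spreadRight r σ).Nodup :=
  List.nodup_cons.2 ⟨h.notMem_trail hσ, nodup_trail σ⟩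

theorem spread_flatMap_spreadLeft (h : IsWord r w) {x : List (Letter N)} (hx : ∀ σ ∈ x, σ ∈ w) :
    Spread r x (x.flatMap (spreadLeft r)) :=
  .flatMap _ (fun σ hσ => h.parentLetter_of_mem_spreadLeft (hx σ hσ))
    fun σ hσ => h.nodup_spreadLeft (hx σ hσ)

theorem spread_flatMap_spreadRight (h : IsWord r w) {x : List (Letter N)}
    (hx : ∀ σ ∈ x, σ ∈ w) : Spread r x (x.flatMap (spreadRight r)) :=
  .flatMap _ (fun σ hσ => h.parentLetter_of_mem_spreadRight (hx σ hσ))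
    fun σ hσ => h.nodup_spreadRight (hx σ hσ)

theorem pairedStrands_of_inl_mem_iff (h : IsWord r w) {w' : List (Letter N)}
    (hw' : ∀ a, .inl a ∈ w' ↔ .inl a ∈ w) : PairedStrands w' := by
  intro a ha
  obtain ⟨u, v, rfl, huv, hmem⟩ := h.pairedStrands a ((hw' a).1 ha)
  exact ⟨u, v, rfl, huv, (hw' _).2 hmem⟩

/-- Two consecutive strands may be swapped. -/
theorem isStep_swap {x z : List (Letter N)} {s t : Letter N} (h : IsWord r (x ++ s :: t :: z)) :
    IsStep r (x ++ s :: t :: z) ((x.flatMap (spreadLeft r) ++ trail r s) ++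
      t :: s :: (trail r t ++ z.flatMap (spreadRight r))) := by
  -- Everything up to `s` sends its links to the left and everything from `t` on to the right, so no
  -- new link comes between `s` and `t`.
  have hspread : Spread r (x ++ s :: t :: z) ((x.flatMap (spreadLeft r) ++ trail r s) ++
      s :: t :: (trail r t ++ z.flatMap (spreadRight r))) := by
    have h1 := h.spread_flatMap_spreadLeft (x := x) (by simp +contextual)
    have h2 := h.spread_flatMap_spreadLeft (x := [s]) (by simp)
    have h3 := h.spread_flatMap_spreadRight (x := t :: z) (by simp +contextual)
    have := h1.append (h2.append h3)
    simpa [spreadLeft, spreadRight] using this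
  have hperm : ((x.flatMap (spreadLeft r) ++ trail r s) ++
      t :: s :: (trail r t ++ z.flatMap (spreadRight r))).Perm
      ((x.flatMap (spreadLeft r) ++ trail r s) ++
      s :: t :: (trail r t ++ z.flatMap (spreadRight r))) :=
    List.Perm.append_left _ (List.Perm.swap _ _ _)
  have hold : ∀ σ ∈ x ++ s :: t :: z, σ ∈ (x.flatMap (spreadLeft r) ++ trail r s) ++
      t :: s :: (trail r t ++ z.flatMap (spreadRight r)) := by
    intro σ hσ
    rcases List.mem_append.1 hσ with hσ | hσ
    · exact List.mem_append_left _ (List.mem_append_left _ (mem_flatMap_spreadLeft hσ))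
    · refine List.mem_append_right _ ?_
      rcases List.mem_cons.1 hσ with rfl | hσ
      · exact List.mem_cons_of_mem _ List.mem_cons_self
      · rcases List.mem_cons.1 hσ with rfl | hσ
        · exact List.mem_cons_self
        · exact List.mem_cons_of_mem _ (List.mem_cons_of_mem _
            (List.mem_append_right _ (mem_flatMap_spreadRight hσ)))
  have hpar : ∀ σ ∈ (x.flatMap (spreadLeft r) ++ trail r s) ++
      t :: s :: (trail r t ++ z.flatMap (spreadRight r)), parentLetter r σ ∈ x ++ s :: t :: z :=
    fun σ hσ => hspread.parent_mem σ (hperm.mem_iff.1 hσ)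
  refine ⟨hperm.nodup_iff.2 (hspread.nodup h.nodup), hspread.atMostOneCrossing_swap h.nodup,
    fun l hl => hold _ hl, ?_, hpar, fun u v huv huv' => absurd (hold _ huv) huv', ?_⟩
  · intro a k ha
    have hk : (.inr ((a, r), k) : Letter N) ∈ trail r (.inl a) := mem_trail.2 ⟨a, k, rfl, rfl⟩
    simp only [List.mem_append, List.mem_cons, List.mem_flatMap, spreadLeft, spreadRight] at ha ⊢
    rcases ha with ha | rfl | rfl | ha
    · exact Or.inl (Or.inl ⟨_, ha, Or.inl hk⟩)
    · exact Or.inl (Or.inr hk)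
    · exact Or.inr (Or.inr (Or.inr (Or.inl hk)))
    · exact Or.inr (Or.inr (Or.inr (Or.inr ⟨_, ha, Or.inr hk⟩)))
  · refine h.pairedStrands_of_inl_mem_iff fun a => ⟨fun ha => ?_, hold _⟩
    have := hpar _ ha
    rcases a with u | ⟨u, v⟩
    · exact this
    · simpa only [parentLetter, if_neg h.pos.ne'] using this

/-- A pair of consecutive strands may be joined. -/
theorem isStep_cap {x z : List (Letter N)} {u v : Fin N}
    (h : IsWord r (x ++ .inl (.inr (u, v)) :: .inl (.inr (v, u)) :: z)) :
    IsStep r (x ++ .inl (.inr (u, v)) :: .inl (.inr (v, u)) :: z)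
      (x.flatMap (spreadLeft r) ++ (trail r (.inl (.inr (u, v))) ++
        (trail r (.inl (.inr (v, u))) ++ z.flatMap (spreadRight r)))) := by
  set s : Letter N := .inl (.inr (u, v)) with hs
  set t : Letter N := .inl (.inr (v, u)) with ht
  have hspread : Spread r (x ++ s :: t :: z) (x.flatMap (spreadLeft r) ++ (trail r s ++
      (trail r t ++ z.flatMap (spreadRight r)))) := by
    -- Both strands end here: their only children are the links that they send out.
    have h1 := h.spread_flatMap_spreadLeft (x := x) (by simp +contextual)
    have h3 := h.spread_flatMap_spreadRight (x := z) (by simp +contextual)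
    exact h1.append (.cons (fun b hb => parentLetter_of_mem_trail hb) (nodup_trail s)
      (.cons (fun b hb => parentLetter_of_mem_trail hb) (nodup_trail t) h3))
  have hold : ∀ σ ∈ x ++ s :: t :: z, σ ≠ s → σ ≠ t → σ ∈ x.flatMap (spreadLeft r) ++ (trail r s ++
      (trail r t ++ z.flatMap (spreadRight r))) := by
    intro σ hσ hσs hσt
    simp only [List.mem_append, List.mem_cons, List.mem_flatMap, spreadLeft, spreadRight] at hσ ⊢
    rcases hσ with hσ | hσ | hσ | hσ
    · exact Or.inl ⟨_, hσ, Or.inr (by simp)⟩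
    · exact absurd hσ hσs
    · exact absurd hσ hσt
    · exact Or.inr (Or.inr (Or.inr ⟨_, hσ, Or.inl rfl⟩))
  have hnew : ∀ a, .inl a ∈ x.flatMap (spreadLeft r) ++ (trail r s ++
      (trail r t ++ z.flatMap (spreadRight r))) → (.inl a ∈ x ∨ .inl a ∈ z) := by
    intro a ha
    rcases List.mem_append.1 ha with ha | ha
    · exact Or.inl (inl_mem_of_mem_flatMap_spreadLeft ha)
    rcases List.mem_append.1 ha with ha | ha
    · exact absurd ha inl_notMem_trail
    rcases List.mem_append.1 ha with ha | ha
    · exact absurd ha inl_notMem_trail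
    · exact Or.inr (inl_mem_of_mem_flatMap_spreadRight ha)
  have hnd := h.nodup
  have hdisj : ∀ σ, σ ∈ x ∨ σ ∈ z → σ ∈ x ++ s :: t :: z ∧ σ ≠ s ∧ σ ≠ t := by
    intro σ hσ
    have hnd := hnd
    rw [List.nodup_append', List.nodup_cons, List.nodup_cons] at hnd
    obtain ⟨-, ⟨hnd1, hnd2, -⟩, hnd3⟩ := hnd
    rcases hσ with hσ | hσ
    · refine ⟨List.mem_append_left _ hσ, ?_, ?_⟩
      · rintro rfl
        exact hnd3 hσ List.mem_cons_self
      · rintro rfl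
        exact hnd3 hσ (List.mem_cons_of_mem _ List.mem_cons_self)
    · refine ⟨List.mem_append_right _ (List.mem_cons_of_mem _ (List.mem_cons_of_mem _ hσ)), ?_, ?_⟩
      · rintro rfl
        exact hnd1 (List.mem_cons_of_mem _ hσ)
      · rintro rfl
        exact hnd2 hσ
  refine ⟨hspread.nodup h.nodup, hspread.atMostOneCrossing h.nodup, ?_, ?_, hspread.parent_mem,
    ?_, ?_⟩
  · exact fun l hl => hold _ hl (by simp [hs]) (by simp [ht])
  · intro a k ha
    have hk : (.inr ((a, r), k) : Letter N) ∈ trail r (.inl a) := mem_trail.2 ⟨a, k, rfl, rfl⟩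
    simp only [List.mem_append, List.mem_cons, List.mem_flatMap, spreadLeft, spreadRight] at ha ⊢
    rcases ha with ha | ha | ha | ha
    · exact Or.inl ⟨_, ha, Or.inl hk⟩
    · exact Or.inr (Or.inl (ha ▸ hk))
    · exact Or.inr (Or.inr (Or.inl (ha ▸ hk)))
    · exact Or.inr (Or.inr (Or.inr ⟨_, ha, Or.inr hk⟩))
  · intro u' v' hmem hnot
    -- Only `s` and `t` disappear, and they are neighbours in the word, so the edge joining them
    -- will be a horizontal segment of length 1.
    have hst : (.inl (.inr (u', v')) : Letter N) = s ∨ (.inl (.inr (u', v')) : Letter N) = t := by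
      by_contra hcon
      rw [not_or] at hcon
      exact hnot (hold _ hmem hcon.1 hcon.2)
    have hsx : s ∉ x := fun hsx => (hdisj s (Or.inl hsx)).2.1 rfl
    have htx : t ∉ x := fun htx => (hdisj t (Or.inl htx)).2.2 rfl
    have hne : s ≠ t := by
      intro hst
      rw [hst] at hnd
      simp [List.nodup_append'] at hnd
    have h1 : place (x ++ s :: t :: z) s = x.length := place_append_cons hsx
    have h2 : place (x ++ s :: t :: z) t = x.length + 1 := by
      have : t ∉ x ++ [s] := by simp [htx, hne.symm]
      simpa using place_append_cons (z := z) this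
    rcases hst with hst | hst
    · obtain ⟨rfl, rfl⟩ : u' = u ∧ v' = v := by simpa [hs] using hst
      right; rw [h1, h2]
    · obtain ⟨rfl, rfl⟩ : u' = v ∧ v' = u := by simpa [ht] using hst
      left; rw [h1, h2]
  · intro a ha
    obtain ⟨hmem, has, hat⟩ := hdisj _ (hnew a ha)
    obtain ⟨u', v', rfl, huv, hmem'⟩ := h.pairedStrands a hmem
    refine ⟨u', v', rfl, huv, hold _ hmem' ?_ ?_⟩
    · rintro heq
      obtain ⟨rfl, rfl⟩ : v' = u ∧ u' = v := by simpa [hs] using heq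
      exact hat rfl
    · rintro heq
      obtain ⟨rfl, rfl⟩ : v' = v ∧ u' = u := by simpa [ht] using heq
      exact has rfl

end IsWord

/-- There is a sequence of steps from the word `w` of row `r` to the word `w'` of row `r'`. -/
def Reaches {N : ℕ} (r : ℕ) (w : List (Letter N)) (r' : ℕ) (w' : List (Letter N)) : Prop :=
  ∃ W : ℕ → List (Letter N), W r = w ∧ W r' = w' ∧ r ≤ r' ∧
    ∀ i, r ≤ i → i < r' → IsStep i (W i) (W (i + 1))

namespace Reaches

variable {N : ℕ} {r r' r'' : ℕ} {w w' w'' : List (Letter N)}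

theorem refl (r : ℕ) (w : List (Letter N)) : Reaches r w r w :=
  ⟨fun _ => w, rfl, rfl, le_rfl, fun i h1 h2 => absurd h2 (by omega)⟩

theorem trans (h : Reaches r w r' w') (h' : Reaches r' w' r'' w'') : Reaches r w r'' w'' := by
  obtain ⟨W, h1, h2, h3, h4⟩ := h
  obtain ⟨W', h1', h2', h3', h4'⟩ := h'
  refine ⟨fun i => if i ≤ r' then W i else W' i, by simp only [if_pos h3, h1], ?_, h3.trans h3',
    fun i hi hi' => ?_⟩
  · by_cases hr : r'' ≤ r'
    · obtain rfl : r'' = r' := le_antisymm hr h3'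
      simp only [if_pos hr]
      rw [h2, ← h1', h2']
    · simp only [if_neg hr, h2']
  · rcases lt_trichotomy i r' with hlt | rfl | hgt
    · simp only [if_pos hlt.le, if_pos (Nat.succ_le_of_lt hlt)]
      exact h4 i hi hlt
    · simp only [if_pos le_rfl, if_neg (Nat.not_succ_le_self i)]
      rw [h2, ← h1']
      exact h4' i le_rfl hi'
    · simp only [if_neg hgt.not_ge, if_neg (show ¬ i + 1 ≤ r' by omega)]
      exact h4' i hgt.le hi'

theorem of_isStep (h : IsStep r w w') : Reaches r w (r + 1) w' :=
  ⟨fun i => if i = r then w else w', by simp, by simp, by omega, fun i h1 h2 => by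
    obtain rfl : i = r := by omega
    simpa using h⟩

theorem isWord (h : Reaches r w r' w') (hw : IsWord r w) : IsWord r' w' := by
  obtain ⟨W, rfl, rfl, hle, hstep⟩ := h
  induction r', hle using Nat.le_induction with
  | base => exact hw
  | succ m hm ih =>
    exact (hstep m hm (by omega)).isWord (ih fun i h1 h2 => hstep i h1 (by omega))

end Reaches

/-! ### Joining all pairs of strands and sorting the links. -/

/-- The number of carriers among the letters of a word. -/
def carrierCount {N : ℕ} (w : List (Letter N)) : ℕ := w.countP Sum.isLeft

/-- The number of links before the first carrier of a word. -/
def linkPrefix {N : ℕ} (w : List (Letter N)) : ℕ := (w.takeWhile Sum.isRight).length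

theorem carrierCount_append {N : ℕ} (x y : List (Letter N)) :
    carrierCount (x ++ y) = carrierCount x + carrierCount y := List.countP_append

theorem carrierCount_cons {N : ℕ} (σ : Letter N) (y : List (Letter N)) :
    carrierCount (σ :: y) = carrierCount y + if σ.isLeft then 1 else 0 := List.countP_cons

theorem carrierCount_trail {N r : ℕ} (σ : Letter N) : carrierCount (trail r σ) = 0 := by
  refine List.countP_eq_zero.2 fun b hb => ?_
  obtain ⟨a, k, -, rfl⟩ := mem_trail.1 hb
  simp

theorem carrierCount_flatMap_spreadLeft {N r : ℕ} (x : List (Letter N)) :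
    carrierCount (x.flatMap (spreadLeft r)) = carrierCount x := by
  induction x with
  | nil => rfl
  | cons σ x ih =>
    rw [List.flatMap_cons, carrierCount_append, ih, spreadLeft, carrierCount_append,
      carrierCount_trail, carrierCount_cons, carrierCount_cons]
    simp [carrierCount, add_comm]

theorem carrierCount_flatMap_spreadRight {N r : ℕ} (x : List (Letter N)) :
    carrierCount (x.flatMap (spreadRight r)) = carrierCount x := by
  induction x with
  | nil => rfl
  | cons σ x ih =>
    rw [List.flatMap_cons, carrierCount_append, ih, spreadRight, carrierCount_cons,
      carrierCount_trail, carrierCount_cons]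
    omega

theorem linkPrefix_cons_inr {N : ℕ} (l : (Carrier N × ℕ) × Fin 3) (y : List (Letter N)) :
    linkPrefix (.inr l :: y) = linkPrefix y + 1 := by
  rw [linkPrefix, List.takeWhile_cons_of_pos (by rfl), List.length_cons, linkPrefix]

/-- New links appear to the right of their carriers, so none precedes the first carrier. -/
theorem linkPrefix_flatMap_spreadRight {N r : ℕ} (x : List (Letter N)) :
    linkPrefix (x.flatMap (spreadRight r)) = linkPrefix x := by
  induction x with
  | nil => rfl
  | cons σ x ih =>
    rcases σ with a | l
    · simp [linkPrefix, spreadRight]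
    · rw [List.flatMap_cons, spreadRight, trail, List.singleton_append, linkPrefix_cons_inr,
        linkPrefix_cons_inr, ih]

/-- The two strands of a pair can be brought together and joined. -/
theorem exists_reaches_carrierCount_lt_of_split {N : ℕ} {u v : Fin N} (y : List (Letter N)) (r : ℕ)
    (x z : List (Letter N))
    (h : IsWord r (x ++ .inl (.inr (u, v)) :: (y ++ .inl (.inr (v, u)) :: z))) :
    ∃ r' w', Reaches r (x ++ .inl (.inr (u, v)) :: (y ++ .inl (.inr (v, u)) :: z)) r' w' ∧
      carrierCount w' <
        carrierCount (x ++ .inl (.inr (u, v)) :: (y ++ .inl (.inr (v, u)) :: z)) := by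
  match y, h with
  | [], h =>
    refine ⟨_, _, .of_isStep h.isStep_cap, ?_⟩
    simp only [carrierCount_append, carrierCount_cons, carrierCount_trail,
      carrierCount_flatMap_spreadLeft, carrierCount_flatMap_spreadRight, List.nil_append]
    simp
  | t :: y, h =>
    rw [List.cons_append] at h ⊢
    have hstep := h.isStep_swap
    -- After the swap, the gap between the two strands consists of the links sent out by `t` and the
    -- spread of `y`; the links sent out by the two strands themselves fall outside.
    have heq : (x.flatMap (spreadLeft r) ++ trail r (.inl (.inr (u, v)))) ++
        t :: .inl (.inr (u, v)) ::
          (trail r t ++ (y ++ .inl (.inr (v, u)) :: z).flatMap (spreadRight r)) =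
        (x.flatMap (spreadLeft r) ++ trail r (.inl (.inr (u, v))) ++ [t]) ++
          .inl (.inr (u, v)) :: ((trail r t ++ y.flatMap (spreadRight r)) ++
            .inl (.inr (v, u)) :: (trail r (.inl (.inr (v, u))) ++ z.flatMap (spreadRight r))) := by
      simp [spreadRight]
    have hcount : carrierCount ((x.flatMap (spreadLeft r) ++ trail r (.inl (.inr (u, v)))) ++
        t :: .inl (.inr (u, v)) ::
          (trail r t ++ (y ++ .inl (.inr (v, u)) :: z).flatMap (spreadRight r))) =
        carrierCount (x ++ .inl (.inr (u, v)) :: t :: (y ++ .inl (.inr (v, u)) :: z)) := by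
      simp only [carrierCount_append, carrierCount_cons, carrierCount_trail,
        carrierCount_flatMap_spreadLeft, carrierCount_flatMap_spreadRight]
      omega
    rw [heq] at hstep hcount
    obtain ⟨r', w', hreach, hlt⟩ := exists_reaches_carrierCount_lt_of_split
      (trail r t ++ y.flatMap (spreadRight r)) (r + 1) _ _ (hstep.isWord h)
    exact ⟨r', w', (Reaches.of_isStep hstep).trans hreach, hcount ▸ hlt⟩
-- Passing a carrier lowers the number of carriers in the gap, however many links appear. Passing a
-- link keeps that number and shortens the run of links before the first carrier, where no new ones
-- arise.
termination_by (carrierCount y, linkPrefix y)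
decreasing_by
  rcases t with a | l
  · left
    simp [carrierCount_append, carrierCount_cons, carrierCount_trail,
      carrierCount_flatMap_spreadRight]
  · have h1 : carrierCount (trail r (.inr l) ++ y.flatMap (spreadRight r)) =
        carrierCount (.inr l :: y) := by
      simp [carrierCount_append, carrierCount_cons, carrierCount_trail,
        carrierCount_flatMap_spreadRight]
    have h2 : linkPrefix (trail r (.inr l) ++ y.flatMap (spreadRight r)) <
        linkPrefix (.inr l :: y) := by
      rw [trail, List.nil_append, linkPrefix_cons_inr, linkPrefix_flatMap_spreadRight]
      exact Nat.lt_succ_self _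
    rw [h1]
    exact Prod.Lex.right _ h2

/-- All pairs of strands can be joined. -/
theorem exists_reaches_carrierCount_eq_zero {N : ℕ} (r : ℕ) (w : List (Letter N))
    (h : IsWord r w) : ∃ r' w', Reaches r w r' w' ∧ carrierCount w' = 0 := by
  induction hn : carrierCount w using Nat.strong_induction_on generalizing r w with
  | _ n ih =>
    by_cases h0 : carrierCount w = 0
    · exact ⟨r, w, .refl r w, h0⟩
    obtain ⟨σ, hσ, hσl⟩ := List.countP_pos_iff.1 (Nat.pos_of_ne_zero h0)
    obtain ⟨a, rfl⟩ := Sum.isLeft_iff.1 hσl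
    obtain ⟨u, v, rfl, huv, hmem⟩ := h.pairedStrands a hσ
    have hsplit : ∃ (u v : Fin N) (x y z : List (Letter N)),
        w = x ++ .inl (.inr (u, v)) :: (y ++ .inl (.inr (v, u)) :: z) := by
      obtain ⟨x, y, rfl⟩ := List.append_of_mem hσ
      have hne : (.inl (.inr (v, u)) : Letter N) ≠ .inl (.inr (u, v)) := by
        intro heq
        simp only [Sum.inl.injEq, Sum.inr.injEq, Prod.mk.injEq] at heq
        exact huv heq.2
      rcases List.mem_append.1 hmem with hmem | hmem
      · obtain ⟨x', y', rfl⟩ := List.append_of_mem hmem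
        exact ⟨v, u, x', y', y, by simp⟩
      · rcases List.mem_cons.1 hmem with hmem | hmem
        · exact absurd hmem hne
        · obtain ⟨x', y', rfl⟩ := List.append_of_mem hmem
          exact ⟨u, v, x, x', y', rfl⟩
    obtain ⟨u, v, x, y, z, rfl⟩ := hsplit
    obtain ⟨r', w', hreach, hlt⟩ := exists_reaches_carrierCount_lt_of_split y r x z h
    obtain ⟨r'', w'', hreach', h0'⟩ := ih _ (hn ▸ hlt) r' w' (hreach.isWord h) rfl
    exact ⟨r'', w'', hreach.trans hreach', h0'⟩

theorem trail_eq_nil {N r : ℕ} {σ : Letter N} (h : σ.isRight) : trail r σ = [] := by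
  obtain ⟨l, rfl⟩ := Sum.isRight_iff.1 h
  rfl

theorem flatMap_spreadLeft_eq_self {N r : ℕ} {x : List (Letter N)} (h : ∀ σ ∈ x, σ.isRight) :
    x.flatMap (spreadLeft r) = x := by
  induction x with
  | nil => rfl
  | cons σ x ih =>
    rw [List.flatMap_cons, ih fun τ hτ => h τ (List.mem_cons_of_mem _ hτ), spreadLeft,
      trail_eq_nil (h σ List.mem_cons_self)]
    rfl

theorem flatMap_spreadRight_eq_self {N r : ℕ} {x : List (Letter N)} (h : ∀ σ ∈ x, σ.isRight) :
    x.flatMap (spreadRight r) = x := by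
  induction x with
  | nil => rfl
  | cons σ x ih =>
    rw [List.flatMap_cons, ih fun τ hτ => h τ (List.mem_cons_of_mem _ hτ), spreadRight,
      trail_eq_nil (h σ List.mem_cons_self)]
    rfl

/-- Words of links can be rearranged arbitrarily. -/
theorem exists_reaches_of_perm {N : ℕ} {y y' : List (Letter N)} (hperm : y.Perm y') :
    ∀ (r : ℕ) (x : List (Letter N)), (∀ σ ∈ x ++ y, σ.isRight) → IsWord r (x ++ y) →
      ∃ r', Reaches r (x ++ y) r' (x ++ y') := by
  induction hperm with
  | nil => exact fun r x _ _ => ⟨r, .refl _ _⟩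
  | @cons a y y' _ ih =>
    intro r x hx hw
    have := ih r (x ++ [a])
    simp only [List.append_assoc, List.singleton_append] at this
    exact this hx hw
  | swap t s y =>
    intro r x hx hw
    -- Without carriers no link is sent out, so the step is a bare transposition.
    have hstep := hw.isStep_swap
    have hy : ∀ σ ∈ s :: t :: y, σ.isRight := fun σ hσ => hx σ (List.mem_append_right _ hσ)
    rw [flatMap_spreadLeft_eq_self fun σ hσ => hx σ (List.mem_append_left _ hσ),
      flatMap_spreadRight_eq_self fun σ hσ =>
        hy σ (List.mem_cons_of_mem _ (List.mem_cons_of_mem _ hσ)),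
      trail_eq_nil (hy s List.mem_cons_self),
      trail_eq_nil (hy t (List.mem_cons_of_mem _ List.mem_cons_self)), List.append_nil,
      List.nil_append] at hstep
    exact ⟨r + 1, .of_isStep hstep⟩
  | trans h1 _ ih1 ih2 =>
    intro r x hx hw
    obtain ⟨r', h'⟩ := ih1 r x hx hw
    obtain ⟨r'', h''⟩ := ih2 r' x
      (fun σ hσ => hx σ ((h1.append_left x).mem_iff.2 hσ)) (h'.isWord hw)
    exact ⟨r'', h'.trans h''⟩

theorem IsWord.isStep_self {N r : ℕ} {w : List (Letter N)} (h : IsWord r w)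
    (hw : ∀ σ ∈ w, σ.isRight) : IsStep r w w := by
  have hspread := h.spread_flatMap_spreadRight (x := w) fun _ => id
  rw [flatMap_spreadRight_eq_self hw] at hspread
  refine ⟨h.nodup, hspread.atMostOneCrossing h.nodup, fun _ => id, fun a _ ha => ?_,
    hspread.parent_mem, fun u v ha ha' => absurd ha ha', h.pairedStrands⟩
  simpa using hw _ ha

/-! ### Existence of schedules. -/

/-- The word of row `0`. -/
def rootWord (N : ℕ) : List (Letter N) := (List.finRange N).map fun u => .inl (.inl u)

/-- The letters of row `1` that continue from a letter of row `0`. -/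
def firstFan {N : ℕ} : Letter N → List (Letter N)
  | .inl (.inl u) => trail 0 (.inl (.inl u)) ++
      ((List.finRange N).filter (· ≠ u)).map fun v => .inl (.inr (u, v))
  | _ => []

/-- Each root fans out, without crossings, into its three links and one strand towards every other
branch vertex. -/
theorem isStep_rootWord (N : ℕ) : IsStep 0 (rootWord N) ((rootWord N).flatMap firstFan) := by
  have hmem : ∀ σ : Letter N, σ ∈ rootWord N ↔ ∃ u, σ = .inl (.inl u) := by
    intro σ
    simp [rootWord, eq_comm]
  have hroot : (rootWord N).Nodup := (List.nodup_finRange N).map fun u v h => by simpa using h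
  have hspread : Spread 0 (rootWord N) ((rootWord N).flatMap firstFan) := by
    refine .flatMap _ ?_ ?_
    · intro σ hσ b hb
      obtain ⟨u, rfl⟩ := (hmem σ).1 hσ
      rcases List.mem_append.1 hb with hb | hb
      · exact parentLetter_of_mem_trail hb
      · obtain ⟨v, -, rfl⟩ := List.mem_map.1 hb
        rfl
    · intro σ hσ
      obtain ⟨u, rfl⟩ := (hmem σ).1 hσ
      refine List.nodup_append'.2 ⟨nodup_trail _, ?_, fun b hb hb' => ?_⟩
      · exact ((List.nodup_finRange N).filter _).map fun v v' h => by simpa using h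
      · obtain ⟨v, -, rfl⟩ := List.mem_map.1 hb'
        exact inl_notMem_trail hb
  have hinl : ∀ a, (.inl a : Letter N) ∈ (rootWord N).flatMap firstFan ↔
      ∃ u v, u ≠ v ∧ a = .inr (u, v) := by
    intro a
    rw [List.mem_flatMap]
    constructor
    · rintro ⟨σ, hσ, ha⟩
      obtain ⟨u, rfl⟩ := (hmem σ).1 hσ
      rcases List.mem_append.1 ha with ha | ha
      · exact absurd ha inl_notMem_trail
      · obtain ⟨v, hv, h⟩ := List.mem_map.1 ha
        have hv' : v ≠ u := by simpa using (List.mem_filter.1 hv).2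
        exact ⟨u, v, hv'.symm, (Sum.inl.inj h).symm⟩
    · rintro ⟨u, v, huv, rfl⟩
      refine ⟨_, (hmem _).2 ⟨u, rfl⟩, List.mem_append_right _ (List.mem_map.2 ⟨v, ?_, rfl⟩)⟩
      simpa using huv.symm
  refine ⟨hspread.nodup hroot, hspread.atMostOneCrossing hroot, ?_, ?_, hspread.parent_mem, ?_, ?_⟩
  · intro l hl
    obtain ⟨u, hu⟩ := (hmem _).1 hl
    simp at hu
  · intro a k ha
    obtain ⟨u, hu⟩ := (hmem _).1 ha
    obtain rfl := Sum.inl.inj hu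
    exact List.mem_flatMap.2 ⟨_, ha, List.mem_append_left _ (mem_trail.2 ⟨_, k, rfl, rfl⟩)⟩
  · intro u v huv
    obtain ⟨_, hu⟩ := (hmem _).1 huv
    simp at hu
  · intro a ha
    obtain ⟨u, v, huv, rfl⟩ := (hinl a).1 ha
    exact ⟨u, v, rfl, huv, (hinl _).2 ⟨v, u, huv.symm, rfl⟩⟩

theorem strand_mem_firstWord {N : ℕ} {u v : Fin N} (huv : u ≠ v) :
    (.inl (.inr (u, v)) : Letter N) ∈ (rootWord N).flatMap firstFan := by
  refine List.mem_flatMap.2 ⟨.inl (.inl u), by simp [rootWord], List.mem_append_right _ ?_⟩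
  exact List.mem_map.2 ⟨v, by simpa using huv.symm, rfl⟩

theorem isWord_firstWord (N : ℕ) : IsWord 1 ((rootWord N).flatMap firstFan) where
  pos := one_pos
  nodup := (isStep_rootWord N).nodup
  lt_of_link_mem a s k h := by
    have := (isStep_rootWord N).parent_mem _ h
    simp only [parentLetter] at this
    split_ifs at this with hs
    · omega
    · simp [rootWord] at this
  pairedStrands := (isStep_rootWord N).pairedStrands

/-- The word of all links from the given hubs, sorted by type. -/
def sortedWord {N : ℕ} (hubs : List (Carrier N × ℕ)) : List (Letter N) :=
  (List.finRange 3).flatMap fun k => hubs.map fun h => .inr (h, k)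

theorem inr_mem_sortedWord {N : ℕ} (hubs : List (Carrier N × ℕ)) (q : Carrier N × ℕ) (k : Fin 3) :
    .inr (q, k) ∈ sortedWord hubs ↔ q ∈ hubs := by
  rw [sortedWord, List.mem_flatMap]
  constructor
  · rintro ⟨k', -, h⟩
    obtain ⟨q', hq', h⟩ := List.mem_map.1 h
    simp only [Sum.inr.injEq, Prod.mk.injEq] at h
    exact h.1 ▸ hq'
  · exact fun h => ⟨k, List.mem_finRange k, List.mem_map.2 ⟨q, h, rfl⟩⟩

/-- Sequences of words that start with the roots and end with the sorted links. -/
structure Schedule (N : ℕ) where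
  word : ℕ → List (Letter N)
  top : ℕ
  hubs : List (Carrier N × ℕ)
  word_zero : word 0 = rootWord N
  word_one : word 1 = (rootWord N).flatMap firstFan
  isStep : ∀ r, IsStep r (word r) (word (r + 1))
  nodup_hubs : hubs.Nodup
  mem_hubs : ∀ a r, (a, r) ∈ hubs ↔ .inl a ∈ word r
  word_of_le : ∀ r, top ≤ r → word r = sortedWord hubs

/-- In a sequence of steps from the roots, the links in a row are those from the hubs in the
rows below. -/
theorem link_mem_iff {N m : ℕ} {W : ℕ → List (Letter N)} (h0 : W 0 = rootWord N)
    (hstep : ∀ i < m, IsStep i (W i) (W (i + 1))) (a : Carrier N) (s : ℕ) (k : Fin 3) :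
    ∀ r ≤ m, .inr ((a, s), k) ∈ W r ↔ s < r ∧ .inl a ∈ W s := by
  intro r
  induction r with
  | zero => simp [h0, rootWord]
  | succ r ih =>
    intro hr
    have ih := ih (by omega)
    have hs := hstep r (by omega)
    constructor
    · intro h
      have := hs.parent_mem _ h
      simp only [parentLetter] at this
      split_ifs at this with hsr
      · subst hsr
        exact ⟨Nat.lt_succ_self _, this⟩
      · obtain ⟨h1, h2⟩ := ih.1 this
        exact ⟨by omega, h2⟩
    · rintro ⟨h1, h2⟩
      by_cases hsr : s = r
      · subst hsr
        exact hs.emit_mem _ _ h2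
      · exact hs.link_mem _ (ih.2 ⟨by omega, h2⟩)

/-- All pairs of strands are joined, after which no hubs arise; the links are then sorted by type
and the sorted word is repeated forever, which leaves room for grids of any height. -/
theorem nonempty_schedule (N : ℕ) : Nonempty (Schedule N) := by
  classical
  obtain ⟨m, w, hreach, hcount⟩ := exists_reaches_carrierCount_eq_zero 1 _ (isWord_firstWord N)
  have hw := hreach.isWord (isWord_firstWord N)
  have hlink : ∀ σ ∈ w, σ.isRight := by
    intro σ hσ
    have := List.countP_eq_zero.1 hcount σ hσ
    simpa using this
  have hreach0 := (Reaches.of_isStep (isStep_rootWord N)).trans hreach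
  obtain ⟨W, hW0, hWm, hm, hW⟩ := hreach0
  have hW' : ∀ i < m, IsStep i (W i) (W (i + 1)) := fun i hi => hW i (Nat.zero_le i) hi
  have hfin : {q : Carrier N × ℕ | q.2 < m ∧ .inl q.1 ∈ W q.2}.Finite :=
    (Set.finite_univ.prod (Set.finite_Iio m)).subset fun q hq => ⟨trivial, hq.1⟩
  let hubs : List (Carrier N × ℕ) := hfin.toFinset.toList
  have hmem : ∀ a r, (a, r) ∈ hubs ↔ r < m ∧ .inl a ∈ W r := by
    intro a r
    simp [hubs]
  have hnodup : hubs.Nodup := Finset.nodup_toList _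
  have hsorted : (sortedWord hubs).Nodup := by
    refine List.nodup_flatMap.2 ⟨fun k _ => hnodup.map fun q q' h => by simpa using h, ?_⟩
    refine (List.nodup_finRange 3).imp fun {k k'} hkk' => ?_
    intro σ hσ hσ'
    obtain ⟨q, -, rfl⟩ := List.mem_map.1 hσ
    obtain ⟨q', -, h⟩ := List.mem_map.1 hσ'
    simp only [Sum.inr.injEq, Prod.mk.injEq] at h
    exact hkk' h.2.symm
  have hperm : w.Perm (sortedWord hubs) := by
    refine (List.perm_ext_iff_of_nodup hw.nodup hsorted).2 fun σ => ?_
    rcases σ with a | ⟨⟨a, s⟩, k⟩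
    · refine iff_of_false (fun h => by simpa using hlink _ h) (by simp [sortedWord])
    · rw [← hWm, link_mem_iff hW0 hW' a s k m le_rfl, ← hmem]
      exact (inr_mem_sortedWord _ _ _).symm
  obtain ⟨m', hreach'⟩ := exists_reaches_of_perm hperm m [] hlink hw
  rw [List.nil_append, List.nil_append] at hreach'
  have hsw := hreach'.isWord hw
  have hslink : ∀ σ ∈ sortedWord hubs, σ.isRight := fun σ hσ => hlink σ (hperm.mem_iff.2 hσ)
  obtain ⟨W', h1, h2, h3, h4⟩ := hreach.trans hreach'
  let X : ℕ → List (Letter N) := fun i =>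
    if i = 0 then rootWord N else if i ≤ m' then W' i else sortedWord hubs
  have hX0 : X 0 = rootWord N := if_pos rfl
  have hX : ∀ i, 0 < i → i ≤ m' → X i = W' i := fun i hi hi' => by
    simp only [X, if_neg hi.ne', if_pos hi']
  have hX' : ∀ i, m' ≤ i → X i = sortedWord hubs := fun i hi => by
    rcases hi.eq_or_lt with rfl | hi
    · rw [hX _ h3 le_rfl, h2]
    · simp only [X, if_neg (show i ≠ 0 by omega), if_neg hi.not_ge]
  have hXword : ∀ i, m' ≤ i → IsWord i (sortedWord hubs) := fun i hi => by
    induction i, hi using Nat.le_induction with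
    | base => exact hsw
    | succ i _ ih => exact (ih.isStep_self hslink).isWord ih
  have hXstep : ∀ i, IsStep i (X i) (X (i + 1)) := by
    intro i
    rcases Nat.eq_zero_or_pos i with rfl | hi
    · rw [hX0, hX 1 one_pos h3, h1]
      exact isStep_rootWord N
    · by_cases him : i < m'
      · rw [hX i hi him.le, hX _ (Nat.succ_pos i) him]
        exact h4 i hi him
      · rw [hX' i (by omega), hX' (i + 1) (by omega)]
        exact (hXword i (by omega)).isStep_self hslink
  refine ⟨X, m', hubs, hX0, (hX 1 one_pos h3).trans h1, hXstep, hnodup, fun a r => ?_, hX'⟩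
  -- Row `r + m' + 1` lies above row `r` and in the sorted range, so the hub is recognised there by
  -- its link of type 0.
  have hiff := link_mem_iff (m := r + m' + 1) hX0 (fun i _ => hXstep i) a r 0 (r + m' + 1) le_rfl
  rw [hX' _ (by omega), inr_mem_sortedWord] at hiff
  rw [hiff]
  exact and_iff_right (by omega)

/-! ### The graph of a schedule and its 1-planarity. -/

namespace Schedule

variable {N : ℕ} (S : Schedule N)

/-- The vertices of the graph drawn along the words of the schedule, up to row `top + m`. -/
abbrev Vertex (m : ℕ) := {p : Letter N × ℕ // p.1 ∈ S.word p.2 ∧ p.2 ≤ S.top + m}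

instance (m : ℕ) : Finite (S.Vertex m) := by
  have : {p : Letter N × ℕ | p.1 ∈ S.word p.2 ∧ p.2 ≤ S.top + m}.Finite := by
    refine ((Set.finite_Iic (S.top + m)).biUnion fun r _ =>
      (List.finite_toSet (S.word r)).image fun σ => (σ, r)).subset ?_
    rintro ⟨σ, r⟩ ⟨h1, h2⟩
    exact Set.mem_biUnion h2 ⟨σ, h1, rfl⟩
  exact this

/-- The edges: letters continue from their parents, the pairs of strands are joined where they end,
and the sorted links are joined to their successors of equal type. -/
def Joined (p q : Letter N × ℕ) : Prop :=
  (q.2 = p.2 + 1 ∧ parentLetter p.2 q.1 = p.1) ∨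
  (q.2 = p.2 ∧ ∃ u v, p.1 = .inl (.inr (u, v)) ∧ q.1 = .inl (.inr (v, u)) ∧
    p.1 ∉ S.word (p.2 + 1)) ∨
  (q.2 = p.2 ∧ S.top ≤ p.2 ∧ ∃ (k : Fin 3) (i : ℕ) (h : i + 1 < S.hubs.length),
    p.1 = .inr (S.hubs[i], k) ∧ q.1 = .inr (S.hubs[i + 1], k))

/-- The graph of the schedule. -/
def graph (m : ℕ) : SimpleGraph (S.Vertex m) := SimpleGraph.fromRel fun p q => S.Joined p q

theorem nodup_word (r : ℕ) : (S.word r).Nodup := by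
  cases r with
  | zero => rw [S.word_zero]; exact (List.nodup_finRange N).map fun u v h => by simpa using h
  | succ r => exact (S.isStep r).nodup

theorem place_hubs_succ {r : ℕ} (hr : S.top ≤ r) (k : Fin 3) {i : ℕ}
    (h : i + 1 < S.hubs.length) :
    place (S.word r) (.inr (S.hubs[i + 1], k)) = place (S.word r) (.inr (S.hubs[i], k)) + 1 := by
  obtain ⟨s, t, hst⟩ := List.append_of_mem (List.mem_finRange k)
  have hsplit : S.hubs = S.hubs.take i ++ S.hubs[i] :: S.hubs[i + 1] :: S.hubs.drop (i + 2) := by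
    rw [List.getElem_cons_drop, List.getElem_cons_drop, List.take_append_drop]
  generalize hg : (S.hubs[i] : Carrier N × ℕ) = g at *
  generalize hg' : (S.hubs[i + 1] : Carrier N × ℕ) = g' at *
  have hword : ∃ x z, S.word r = x ++ .inr (g, k) :: .inr (g', k) :: z := by
    rw [S.word_of_le r hr, sortedWord, hst, hsplit]
    simp only [List.flatMap_append, List.flatMap_cons, List.map_append, List.map_cons]
    exact ⟨s.flatMap (fun k => (S.hubs.take i ++ g :: g' :: S.hubs.drop (i + 2)).map
      fun h => .inr (h, k)) ++ (S.hubs.take i).map (fun h => .inr (h, k)), _, by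
        simp only [List.append_assoc, List.cons_append, List.map_append, List.map_cons]; rfl⟩
  obtain ⟨x, z, hxz⟩ := hword
  have hnd := S.nodup_word r
  rw [hxz] at hnd ⊢
  have hnd' : (.inr (g', k) : Letter N) ∉ x ++ [.inr (g, k)] := by
    intro hmem
    rw [List.append_cons] at hnd
    exact (List.nodup_append'.1 hnd).2.2 hmem List.mem_cons_self
  have hnd0 : (.inr (g, k) : Letter N) ∉ x := by
    intro hmem
    exact (List.nodup_append'.1 hnd).2.2 hmem List.mem_cons_self
  rw [place_append_cons hnd0]
  simpa using place_append_cons (z := z) hnd'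

/-- Horizontal edges have length 1, as `isOnePlanar_of_layered` requires: strands end as neighbours,
and rungs join neighbours in the sorted word. -/
theorem place_of_joined {p q : Letter N × ℕ} (hp : p.1 ∈ S.word p.2) (h : S.Joined p q)
    (hpq : q.2 = p.2) : place (S.word q.2) q.1 = place (S.word p.2) p.1 + 1 ∨
      place (S.word p.2) p.1 = place (S.word q.2) q.1 + 1 := by
  rw [hpq]
  rcases h with ⟨h, -⟩ | ⟨-, u, v, h1, h2, h3⟩ | ⟨-, hr, k, i, hi, h1, h2⟩
  · omega
  · rw [h1] at hp h3
    rw [h1, h2]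
    exact ((S.isStep p.2).adjacent_of_notMem u v hp h3).symm
  · rw [h1, h2]
    exact Or.inl (S.place_hubs_succ hr k hi)

theorem Joined.row_eq {p q : Letter N × ℕ} (h : S.Joined p q) :
    q.2 = p.2 + 1 ∧ parentLetter p.2 q.1 = p.1 ∨ q.2 = p.2 :=
  h.imp_right fun h => h.elim And.left And.left

theorem graph_adj_iff {m : ℕ} {p q : S.Vertex m} :
    (S.graph m).Adj p q ↔ S.Joined p q ∨ S.Joined q p := by
  rw [graph, SimpleGraph.fromRel_adj, and_iff_right_iff_imp]
  rintro h rfl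
  have h : S.Joined p p := h.elim id id
  have := S.place_of_joined p.2.1 h rfl
  omega

theorem parentLetter_of_adj {m : ℕ} {p q : S.Vertex m} (h : (S.graph m).Adj p q)
    (hpq : q.1.2 = p.1.2 + 1) : parentLetter p.1.2 q.1.1 = p.1.1 := by
  rcases S.graph_adj_iff.1 h with h | h
  · rcases h.row_eq with h | h
    · exact h.2
    · omega
  · rcases h.row_eq with h | h <;> omega

/-- The drawing uses the place in the word and the row as coordinates. A rising edge is determined
by its upper end, so the single inverted pair of letters permitted by `AtMostOneCrossing` accounts
for all inversions between two rows. -/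
theorem isOnePlanar_graph (m : ℕ) : IsOnePlanar (S.graph m) := by
  refine isOnePlanar_of_layered _ (fun p => place (S.word p.1.2) p.1.1) (fun p => p.1.2)
    ?_ ?_ ?_
  · rintro ⟨⟨σ, r⟩, hp⟩ ⟨⟨τ, r'⟩, hq⟩ h (rfl : r = r')
    obtain rfl : σ = τ := eq_of_place_eq hp.1 h
    rfl
  · intro p q h
    by_cases hpq : q.1.2 = p.1.2
    · refine Or.inr (Or.inr ⟨hpq.symm, ?_⟩)
      rcases S.graph_adj_iff.1 h with h | h
      · exact S.place_of_joined p.2.1 h hpq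
      · exact (S.place_of_joined q.2.1 h hpq.symm).symm
    · rcases S.graph_adj_iff.1 h with h | h
      · rcases h.row_eq with h | h
        · exact Or.inl h.1
        · exact absurd h hpq
      · rcases h.row_eq with h | h
        · exact Or.inr (Or.inl h.1)
        · exact absurd h.symm hpq
  · intro a b a' b' a'' b'' h h' h'' hb ha' hb' ha'' hb'' hi hi'
    obtain ⟨p, hp⟩ := (S.isStep a.1.2).atMostOneCrossing
    have e := S.parentLetter_of_adj h hb
    have e' := S.parentLetter_of_adj h' (by rw [hb', ha'])
    have e'' := S.parentLetter_of_adj h'' (by rw [hb'', ha''])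
    have mb := b.2.1
    have mb' := b'.2.1
    have mb'' := b''.2.1
    obtain ⟨⟨a, r⟩, ha0⟩ := a
    obtain ⟨⟨b, rb⟩, hb0⟩ := b
    obtain ⟨⟨a', ra'⟩, ha0'⟩ := a'
    obtain ⟨⟨b', rb'⟩, hb0'⟩ := b'
    obtain ⟨⟨a'', row⟩, ha0''⟩ := a''
    obtain ⟨⟨b'', rb''⟩, hb0''⟩ := b''
    dsimp only at *
    subst hb ha' hb' ha'' hb'' e e' e''
    have key : ∀ c c', c ∈ S.word (row + 1) → c' ∈ S.word (row + 1) →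
        place (S.word row) (parentLetter row c') < place (S.word row) (parentLetter row c) →
        place (S.word (row + 1)) c < place (S.word (row + 1)) c' → p = some (c, c') :=
      fun c c' hc hc' h1 h2 => (rel_of_place_lt hp hc hc' h2).resolve_left h1.not_ge
    suffices b' = b'' by subst this; exact ⟨rfl, rfl⟩
    -- The edge ending at `b` can occupy only one position in the permitted pair, so the mixed cases
    -- are contradictory.
    rcases hi with ⟨h1, h2⟩ | ⟨h1, h2⟩ <;> rcases hi' with ⟨h3, h4⟩ | ⟨h3, h4⟩ <;>
      dsimp only at h1 h2 h3 h4
    · have := (key _ _ mb' mb h1 h2).symm.trans (key _ _ mb'' mb h3 h4)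
      simp only [Option.some.injEq, Prod.mk.injEq] at this
      exact this.1
    · have := (key _ _ mb' mb h1 h2).symm.trans (key _ _ mb mb'' h3 h4)
      simp only [Option.some.injEq, Prod.mk.injEq] at this
      rw [this.1] at h2
      exact absurd h2 (lt_irrefl _)
    · have := (key _ _ mb mb' h1 h2).symm.trans (key _ _ mb'' mb h3 h4)
      simp only [Option.some.injEq, Prod.mk.injEq] at this
      rw [this.2] at h2
      exact absurd h2 (lt_irrefl _)
    · have := (key _ _ mb mb' h1 h2).symm.trans (key _ _ mb mb'' h3 h4)
      simp only [Option.some.injEq, Prod.mk.injEq] at this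
      exact this.2

/-! ### The graph of a schedule as a lane system. -/

theorem row_lt_top {a : Carrier N} {r : ℕ} (h : .inl a ∈ S.word r) : r < S.top := by
  by_contra! hr
  rw [S.word_of_le r hr, sortedWord] at h
  simp at h

theorem link_mem_word_iff (q : Carrier N × ℕ) (k : Fin 3) (r : ℕ) :
    .inr (q, k) ∈ S.word r ↔ q.2 < r ∧ q ∈ S.hubs := by
  rw [S.mem_hubs]
  exact link_mem_iff S.word_zero (fun i _ => S.isStep i) q.1 q.2 k r le_rfl

/-- The `i`-th hub. -/
def hub (m : ℕ) (i : Fin S.hubs.length) : S.Vertex m :=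
  ⟨(.inl S.hubs[i].1, S.hubs[i].2), by
    have h := (S.mem_hubs S.hubs[i].1 S.hubs[i].2).1 (List.getElem_mem i.2)
    exact ⟨h, (S.row_lt_top h).le.trans (Nat.le_add_right _ _)⟩⟩

/-- The lane of type `k` from the `i`-th hub. -/
def lane (m : ℕ) (k : Fin 3) (i : Fin S.hubs.length) (r : ℕ) : S.Vertex m :=
  if h : S.hubs[i].2 < r ∧ r ≤ S.top + m then
    ⟨(.inr (S.hubs[i], k), r), (S.link_mem_word_iff _ k r).2 ⟨h.1, List.getElem_mem i.2⟩, h.2⟩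
  else S.hub m i

theorem exists_hub_eq {m : ℕ} {a : Carrier N} {r : ℕ} (h) :
    ∃ i, (⟨(.inl a, r), h⟩ : S.Vertex m) = S.hub m i ∧ S.hubs[i] = (a, r) := by
  obtain ⟨i, hi, he⟩ := List.getElem_of_mem ((S.mem_hubs a r).2 h.1)
  refine ⟨⟨i, hi⟩, Subtype.ext ?_, he⟩
  simp [hub, he]

theorem val_lane {m : ℕ} {k : Fin 3} {i : Fin S.hubs.length} {r : ℕ} (h1 : S.hubs[i].2 < r)
    (h2 : r ≤ S.top + m) : (S.lane m k i r).1 = (.inr (S.hubs[i], k), r) := by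
  rw [lane, dif_pos ⟨h1, h2⟩]

theorem lane_of_le {m : ℕ} {k : Fin 3} {i : Fin S.hubs.length} {r : ℕ} (h : r ≤ S.hubs[i].2) :
    S.lane m k i r = S.hub m i := by
  rw [lane, dif_neg (by omega)]

theorem exists_lane_eq {m : ℕ} {q : Carrier N × ℕ} {k : Fin 3} {r : ℕ} (h) :
    ∃ i, (⟨(.inr (q, k), r), h⟩ : S.Vertex m) = S.lane m k i r ∧ S.hubs[i] = q ∧
      S.hubs[i].2 < r := by
  obtain ⟨hr, hq⟩ := (S.link_mem_word_iff _ k r).1 h.1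
  obtain ⟨i, hi, rfl⟩ := List.getElem_of_mem hq
  exact ⟨⟨i, hi⟩, Subtype.ext (S.val_lane (i := ⟨i, hi⟩) hr h.2).symm, rfl, hr⟩

theorem row_lt (i : Fin S.hubs.length) : S.hubs[i].2 < S.top :=
  S.row_lt_top ((S.mem_hubs S.hubs[i].1 _).1 (List.getElem_mem i.2))

/-- Carriers have carriers as parents, and a link continues the same lane or leaves its hub; the
joins of strands connect hubs, and the rungs connect lanes of equal type. -/
theorem adj_cases_of_joined {m : ℕ} {p q : S.Vertex m} (h : S.Joined p q) :
    (∃ i j, p = S.hub m i ∧ q = S.hub m j) ∨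
    (∃ k j r, r < S.top + m ∧ s(p, q) = s(S.lane m k j r, S.lane m k j (r + 1))) ∨
    ∃ k i j r, 0 < r ∧ r ≤ S.top + m ∧ s(p, q) = s(S.lane m k i r, S.lane m k j r) := by
  obtain ⟨⟨σ, r⟩, hp⟩ := p
  obtain ⟨⟨τ, r'⟩, hq⟩ := q
  rcases h with ⟨h1, h2⟩ | ⟨h1, u, v, h2, h3, -⟩ | ⟨h1, h0, k, i, hi, h2, h3⟩ <;>
    dsimp only at h1 h2
  · subst h1 h2
    rcases τ with a | ⟨⟨a, s⟩, k⟩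
    · left
      have : ∃ b : Carrier N, parentLetter r (.inl a) = .inl b := by
        rcases a with u | ⟨u, v⟩
        · exact ⟨_, rfl⟩
        · simp only [parentLetter]
          split_ifs
          · exact ⟨_, rfl⟩
          · exact ⟨_, rfl⟩
      obtain ⟨b, hb⟩ := this
      simp only [hb] at hp ⊢
      obtain ⟨i, hi, -⟩ := S.exists_hub_eq hp
      obtain ⟨j, hj, -⟩ := S.exists_hub_eq hq
      exact ⟨i, j, hi, hj⟩
    · right; left
      obtain ⟨i, hi, hs, hlt⟩ := S.exists_lane_eq hq
      refine ⟨k, i, r, hq.2, ?_⟩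
      rw [hi]
      refine congrArg (fun p => s(p, S.lane m k i (r + 1))) (Subtype.ext ?_)
      by_cases hsr : s = r
      · subst hsr
        rw [S.lane_of_le (by rw [hs])]
        simp [hub, parentLetter, hs]
      · rw [hs] at hlt
        rw [S.val_lane (by rw [hs]; dsimp only at hlt ⊢; omega) hp.2]
        simp [parentLetter, hsr, hs]
  · left
    subst h2 h3
    obtain ⟨i, hi, -⟩ := S.exists_hub_eq hp
    obtain ⟨j, hj, -⟩ := S.exists_hub_eq hq
    exact ⟨i, j, hi, hj⟩
  · right; right
    dsimp only at h0 h3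
    subst h1 h2 h3
    obtain ⟨i', hi', -, hlt⟩ := S.exists_lane_eq hp
    obtain ⟨j', hj', -, -⟩ := S.exists_lane_eq hq
    exact ⟨k, i', j', r', by omega, hp.2, by rw [hi', hj']⟩

/-- The graph of a schedule is a lane system. -/
def laneSystem (m : ℕ) : LaneSystem (S.graph m) S.hubs.length S.top (S.top + m) where
  hub := S.hub m
  row i := S.hubs[i].2
  lane := S.lane m
  row_lt := S.row_lt
  lane_of_le k j r h := S.lane_of_le h
  hub_injective i j h := by
    have h := congrArg Subtype.val h
    simp only [hub, Prod.mk.injEq, Sum.inl.injEq] at h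
    exact Fin.ext ((List.Nodup.getElem_inj_iff S.nodup_hubs).1 (Prod.ext h.1 h.2))
  lane_ne_hub k j r i h1 h2 h := by
    have h := congrArg Subtype.val h
    rw [S.val_lane h1 h2] at h
    simp [hub] at h
  lane_inj k j r k' j' r' h1 h2 h3 h4 h := by
    have h := congrArg Subtype.val h
    rw [S.val_lane h1 h2, S.val_lane h3 h4] at h
    simp only [Prod.mk.injEq, Sum.inr.injEq] at h
    exact ⟨h.1.2, Fin.ext ((List.Nodup.getElem_inj_iff S.nodup_hubs).1 h.1.1), h.2⟩
  cover := by
    rintro ⟨⟨a | ⟨q, k⟩, r⟩, hp⟩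
    · obtain ⟨i, hi, -⟩ := S.exists_hub_eq hp
      exact Or.inl ⟨i, hi⟩
    · obtain ⟨i, hi, -, hlt⟩ := S.exists_lane_eq hp
      exact Or.inr ⟨k, i, r, hlt, hp.2, hi⟩
  adj_cases p q h := by
    rcases S.graph_adj_iff.1 h with h | h
    · exact S.adj_cases_of_joined h
    · rw [Sym2.eq_swap]
      exact (S.adj_cases_of_joined h).imp_left fun ⟨i, j, hi, hj⟩ => ⟨j, i, hj, hi⟩
  lane_adj k j r h1 h2 := by
    refine S.graph_adj_iff.2 (Or.inl (Or.inl ?_))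
    rw [S.val_lane (by omega) h2]
    rcases h1.eq_or_lt with rfl | h1
    · rw [S.lane_of_le le_rfl]
      simp [hub, parentLetter]
    · rw [S.val_lane h1 h2.le]
      exact ⟨rfl, if_neg h1.ne⟩
  rung_adj k i j r h1 h2 hij := by
    refine S.graph_adj_iff.2 (Or.inl (Or.inr (Or.inr ?_)))
    have hi := S.row_lt i
    have hj := S.row_lt j
    rw [S.val_lane (by omega) h2, S.val_lane (by omega) h2]
    exact ⟨rfl, h1, k, i, hij ▸ j.2, rfl, by simp [← hij]⟩

/-! ### Subdivisions carried by the hubs. -/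

/-- The branch vertex to which a carrier belongs. -/
def owner : Carrier N → Fin N
  | .inl u => u
  | .inr (u, _) => u

/-- The condition `0 < r` makes `lastRow` positive even for `u = v`, where there is no strand. -/
theorem exists_strand_notMem (u v : Fin N) :
    ∃ r, 0 < r ∧ .inl (.inr (u, v)) ∉ S.word (r + 1) :=
  ⟨S.top + 1, Nat.succ_pos _, fun h => by have := S.row_lt_top h; omega⟩

open Classical in
/-- The row in which the strand from `u` towards `v` ends. -/
noncomputable def lastRow (u v : Fin N) : ℕ := Nat.find (S.exists_strand_notMem u v)

theorem lastRow_pos (u v : Fin N) : 0 < S.lastRow u v := by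
  classical exact (Nat.find_spec (S.exists_strand_notMem u v)).1

theorem strand_notMem (u v : Fin N) : .inl (.inr (u, v)) ∉ S.word (S.lastRow u v + 1) := by
  classical exact (Nat.find_spec (S.exists_strand_notMem u v)).2

theorem strand_mem {u v : Fin N} (huv : u ≠ v) {r : ℕ} (h0 : 0 < r) (hr : r ≤ S.lastRow u v) :
    .inl (.inr (u, v)) ∈ S.word r := by
  classical
  obtain ⟨r, rfl⟩ : ∃ s, r = s + 1 := ⟨r - 1, by omega⟩
  rcases Nat.eq_zero_or_pos r with rfl | h
  · rw [S.word_one]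
    exact strand_mem_firstWord huv
  · have := Nat.find_min (S.exists_strand_notMem u v) (m := r) hr
    simpa [h] using this

theorem strand_mem_comm (u v : Fin N) (r : ℕ) (h : .inl (.inr (u, v)) ∈ S.word (r + 1)) :
    .inl (.inr (v, u)) ∈ S.word (r + 1) := by
  obtain ⟨u', v', he, -, h'⟩ := (S.isStep r).pairedStrands _ h
  obtain ⟨rfl, rfl⟩ : u = u' ∧ v = v' := by simpa using he
  exact h'

/-- Strands occur in pairs, so the two halves of a subdivided edge end in the same row, where they
are joined. -/
theorem lastRow_comm (u v : Fin N) : S.lastRow u v = S.lastRow v u := by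
  classical
  refine Nat.find_congr' fun {r} => and_congr_right fun _ => not_congr ?_
  exact ⟨S.strand_mem_comm u v r, S.strand_mem_comm v u r⟩

theorem root_mem (u : Fin N) : .inl (.inl u) ∈ S.word 0 := by
  simp [S.word_zero, rootWord]

open Classical in
/-- The vertex in row `r` of the strand from `u` towards `v`. -/
noncomputable def strand (m : ℕ) (u v : Fin N) (r : ℕ) : S.Vertex m :=
  if h : 0 < r ∧ .inl (.inr (u, v)) ∈ S.word r then
    ⟨(.inl (.inr (u, v)), r), h.2, (S.row_lt_top h.2).le.trans (Nat.le_add_right _ _)⟩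
  else ⟨(.inl (.inl u), 0), S.root_mem u, Nat.zero_le _⟩

theorem val_strand_zero (m : ℕ) (u v : Fin N) : (S.strand m u v 0).1 = (.inl (.inl u), 0) := by
  rw [strand, dif_neg (by omega)]

theorem val_strand {m : ℕ} {u v : Fin N} (huv : u ≠ v) {r : ℕ} (h0 : 0 < r)
    (hr : r ≤ S.lastRow u v) : (S.strand m u v r).1 = (.inl (.inr (u, v)), r) := by
  rw [strand, dif_pos ⟨h0, S.strand_mem huv h0 hr⟩]

/-- The half of each subdivided edge at `u` consists of hubs owned by `u`, so a missing hub harms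
only one branch vertex. -/
theorem exists_strand_eq_hub (m : ℕ) (u v : Fin N) (r : ℕ) :
    ∃ i, S.strand m u v r = S.hub m i ∧ owner S.hubs[i].1 = u := by
  rw [strand]
  split_ifs with h
  · obtain ⟨i, hi, he⟩ := S.exists_hub_eq (m := m) (a := .inr (u, v)) (r := r)
      ⟨h.2, (S.row_lt_top h.2).le.trans (Nat.le_add_right _ _)⟩
    exact ⟨i, hi, by rw [he]; rfl⟩
  · obtain ⟨i, hi, he⟩ := S.exists_hub_eq (m := m) (a := .inl u) (r := 0)
      ⟨S.root_mem u, Nat.zero_le _⟩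
    exact ⟨i, hi, by rw [he]; rfl⟩

theorem strand_adj {m : ℕ} {u v : Fin N} (huv : u ≠ v) {r : ℕ} (hr : r < S.lastRow u v) :
    (S.graph m).Adj (S.strand m u v r) (S.strand m u v (r + 1)) := by
  refine S.graph_adj_iff.2 (Or.inl (Or.inl ?_))
  rw [S.val_strand huv (Nat.succ_pos r) hr]
  rcases Nat.eq_zero_or_pos r with rfl | h0
  · rw [S.val_strand_zero]
    simp [parentLetter]
  · rw [S.val_strand huv h0 hr.le]
    simp [parentLetter, h0.ne']

theorem strand_adj_strand {m : ℕ} {u v : Fin N} (huv : u ≠ v) :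
    (S.graph m).Adj (S.strand m u v (S.lastRow u v)) (S.strand m v u (S.lastRow v u)) := by
  refine S.graph_adj_iff.2 (Or.inl (Or.inr (Or.inl ?_)))
  rw [S.val_strand huv (S.lastRow_pos u v) le_rfl,
    S.val_strand huv.symm (S.lastRow_pos v u) le_rfl]
  exact ⟨S.lastRow_comm v u, u, v, rfl, rfl, S.strand_notMem u v⟩

/-- A set that contains all hubs of the branch vertices `f u` contains a subdivision. -/
theorem isTopologicalMinor_induce {U : Type*} (H : SimpleGraph U) (f : U ↪ Fin N) {m : ℕ}
    {s : Set (S.Vertex m)} (hs : ∀ u i, owner S.hubs[i].1 = f u → S.hub m i ∈ s) :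
    IsTopologicalMinor H ((S.graph m).induce s) := by
  have hmem : ∀ u v r, S.strand m (f u) v r ∈ s := by
    intro u v r
    obtain ⟨i, hi, ho⟩ := S.exists_strand_eq_hub m (f u) v r
    exact hi ▸ hs u i ho
  have hval : ∀ u v, H.Adj u v → ∀ r ≤ S.lastRow (f u) (f v),
      (S.strand m (f u) (f v) r).1 =
        if r = 0 then (.inl (.inl (f u)), 0) else (.inl (.inr (f u, f v)), r) := by
    intro u v h r hr
    split_ifs with h0
    · rw [h0, S.val_strand_zero]
    · exact S.val_strand (f.injective.ne h.ne) (Nat.pos_of_ne_zero h0) hr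
  refine isTopologicalMinor_of_strands H (fun u v r => ⟨S.strand m (f u) (f v) r, hmem u _ r⟩)
    -- In row 0 a strand is at its root, whatever its target.
    (fun u => ⟨S.strand m (f u) (f u) 0, hmem u _ 0⟩) (fun u v => S.lastRow (f u) (f v))
    ?_ ?_ ?_ ?_ ?_ ?_
  · intro u v
    refine Subtype.ext (Subtype.ext ?_)
    rw [S.val_strand_zero, S.val_strand_zero]
  · exact fun u v h r hr => S.strand_adj (f.injective.ne h.ne) hr
  · exact fun u v h => S.strand_adj_strand (f.injective.ne h.ne)
  · intro u v h
    have h := congrArg (fun p => p.1.1) h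
    simp only [S.val_strand_zero] at h
    exact f.injective (by simpa using h)
  · intro u v r w h hr he
    have he := congrArg (fun p => p.1.1) he
    simp only [S.val_strand_zero, hval u v h r hr] at he
    split_ifs at he with h0
    · exact (f.injective (by simpa using he)).symm
    · simp at he
  · intro u v r u' v' r' h h' hr hr' he
    have he := congrArg (fun p => p.1.1) he
    simp only [hval u v h r hr, hval u' v' h' r' hr'] at he
    split_ifs at he with h0 h0' h0'
    · exact ⟨f.injective (by simpa using he), by omega, Or.inr h0⟩
    · simp at he
    · simp at he
    · simp only [Prod.mk.injEq, Sum.inl.injEq, Sum.inr.injEq, f.injective.eq_iff] at he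
      exact ⟨he.1.1, he.2, Or.inl he.1.2⟩

/-- If few hubs are missing from a set, then all hubs of many branch vertices are present. -/
theorem exists_embedding_of_ncard_le {U : Type*} [Finite U] {m c : ℕ} {s : Set (S.Vertex m)}
    (hN : Nat.card U + c ≤ N) (hs : {i | S.hub m i ∉ s}.ncard ≤ c) :
    ∃ f : U ↪ Fin N, ∀ u i, owner S.hubs[i].1 = f u → S.hub m i ∈ s := by
  have := Fintype.ofFinite U
  -- Each missing hub has one owner, so at most `c` of the `N` branch vertices are lost.
  let bad : Set (Fin N) := (fun i => owner S.hubs[i].1) '' {i | S.hub m i ∉ s}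
  have hbad : bad.ncard ≤ c := (Set.ncard_image_le (Set.toFinite _)).trans hs
  have hgood : Nat.card U ≤ Nat.card (badᶜ : Set (Fin N)) := by
    have := Set.ncard_add_ncard_compl bad
    rw [Nat.card_fin] at this
    rw [Nat.card_coe_set_eq]
    omega
  obtain ⟨g⟩ : Nonempty (U ↪ (badᶜ : Set (Fin N))) := by
    have := Fintype.ofFinite (badᶜ : Set (Fin N))
    rw [Nat.card_eq_fintype_card, Nat.card_eq_fintype_card] at hgood
    exact Function.Embedding.nonempty_of_card_le hgood
  refine ⟨g.trans (Function.Embedding.subtype _), fun u i hi => ?_⟩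
  by_contra hcon
  exact (g u).2 ⟨i, hcon, hi⟩

end Schedule

/-! ### The theorem. -/

theorem exists_isOnePlanar_isTopologicalMinor_bag (c : ℕ) {V₀ : Type*} [Finite V₀]
    (G₀ : SimpleGraph V₀) :
    ∃ (V : Type) (_ : Finite V) (G : SimpleGraph V), IsOnePlanar G ∧
      ∀ (ι : Type) [Fintype ι] (T : SimpleGraph ι) (B : ι → Finset V),
        IsTreeDecomposition G T B → bagWidth B < treewidth G + (c : ℤ) →
          ∃ x : ι, IsTopologicalMinor G₀ (G.induce (B x : Set V)) := by
  obtain ⟨S⟩ := nonempty_schedule (Nat.card V₀ + c)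
  let n := S.hubs.length
  -- The grids extend `n + c` rows above row `top`, matching the bound on the bag sizes.
  refine ⟨S.Vertex (n + c), inferInstance, S.graph (n + c), S.isOnePlanar_graph _, ?_⟩
  intro ι _ T B hT hB
  have htw := (S.laneSystem (n + c)).treewidth_le
  -- The width is less than `tw + c ≤ n + c`, and a bag has at most one vertex more than the width.
  have hcard : ∀ x, (B x).card ≤ n + c := by
    intro x
    have h : (B x).card ≤ Finset.univ.sup fun x => (B x).card :=
      Finset.le_sup (f := fun x => (B x).card) (Finset.mem_univ x)
    rw [bagWidth] at hB
    omega
  obtain ⟨x, hx⟩ := (S.laneSystem (n + c)).exists_bag_hubs hT hcard le_rfl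
  obtain ⟨f, hf⟩ := S.exists_embedding_of_ncard_le (U := V₀) (m := n + c) (s := (B x : Set _))
    le_rfl hx
  exact ⟨x, S.isTopologicalMinor_induce G₀ f hf⟩

theorem theorem4 :
    (∀ (c : ℕ) {V₀ : Type*} [Finite V₀] (G₀ : SimpleGraph V₀),
      ∃ (V : Type) (_ : Finite V) (G : SimpleGraph V), IsOnePlanar G ∧
        ∀ (ι : Type) [Fintype ι] (T : SimpleGraph ι) (B : ι → Finset V),
          IsTreeDecomposition G T B → bagWidth B < treewidth G + (c : ℤ) →
            ∃ x : ι, IsTopologicalMinor G₀ (G.induce (B x : Set V))) ∧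
    (∀ c w : ℕ,
      ∃ (V : Type) (_ : Finite V) (G : SimpleGraph V), IsOnePlanar G ∧
        ∀ (ι : Type) [Fintype ι] (T : SimpleGraph ι) (B : ι → Finset V),
          IsTreeDecomposition G T B → bagWidth B ≤ treewidth G + (c : ℤ) →
            ∃ x : ι, (w : ℤ) < treewidth (G.induce (B x : Set V))) := by
  refine ⟨fun c V₀ _ G₀ => exists_isOnePlanar_isTopologicalMinor_bag c G₀, fun c w => ?_⟩
  -- Using `c + 1` turns the strict bound on the width into a weak one, and a complete topological
  -- minor on `w + 2` vertices forces treewidth at least `w + 1`.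
  obtain ⟨V, hV, G, hG, h⟩ := exists_isOnePlanar_isTopologicalMinor_bag (c + 1)
    (⊤ : SimpleGraph (Fin (w + 2)))
  refine ⟨V, hV, G, hG, fun ι _ T B hT hB => ?_⟩
  obtain ⟨x, hx⟩ := h ι T B hT (by push_cast; omega)
  have := le_treewidth_of_isTopologicalMinor hx
  exact ⟨x, by push_cast at this; omega⟩
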